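/- Let $\Bbbk$ be an infinite field, let $n,r\ge 0$ be integers, and let $V_N=\Bbbk^N$ (column vectors, standard basis $e_1,\dots,e_N$). Let $\lambda/\mu$ be a skew partition of $r$, i.e. $\mu\subseteq\lambda$ are partitions with $|\lambda|-|\mu|=r$; write $\lambda',\mu'$ for the transposed partitions. For a finite-dimensional space $V$ and a skew partition $\alpha/\beta$ with row lengths $a_i=\alpha_i-\beta_i$ and column lengths $b_j=\alpha'_j-\beta'_j$, let $$d_{\alpha/\beta}(V):\bigotimes_i\Lambda^{a_i}(V)\to\bigotimes_j Sym_{b_j}(V),\qquad d'_{\alpha/\beta}(V):\bigotimes_i D_{a_i}(V)\to\bigotimes_j\Lambda^{b_j}(V)$$ be the maps obtained by comultiplying every row into $V^{\otimes a_i}$ (one factor for each cell of the row) and then multiplying the factors along each column, from top to bottom; here $D_m(V)=Sym_m(V^*)^*$ is the divided power. The Schur module $L_{\alpha/\beta}(V)$ is the image of $d_{\alpha/\beta}(V)$ and the Weyl module $K_{\alpha/\beta}(V)$ is the image of $d'_{\alpha/\beta}(V)$. For a filling $T$ of the diagram of $\alpha/\beta$ with entries in $[n]=\{1,\dots,n\}$,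 let $X_T=\bigotimes_i e_{T(i,1)}\wedge\cdots\wedge e_{T(i,a_i)}$, where $T(i,k)$ is the $k$-th entry of row $i$, and $Y_T=\bigotimes_i e_1^{(a_{i1})}\cdots e_n^{(a_{in})}$, where $a_{ij}$ is the number of entries equal to $j$ in row $i$ of $T$. The filling $T$ is semistandard if its entries increase strictly along rows and weakly down columns. The monoid of $N\times N$ matrices acts on $M=L_{\alpha/\beta}(V_N)$ and on $M=K_{\alpha/\beta}(V_N)$. For $\omega\in\mathbb Z_{\ge0}^N$ let $M^\omega=\{v\in M:\operatorname{diag}(t_1,\dots,t_N)v=t_1^{\omega_1}\cdots t_N^{\omega_N}v\text{ for all }t_i\in\Bbbk^\times\}$, and let $M''$ be the sum of the spaces $M^\omega$ over all $\omega$ with $\sum_i\omega_i=r$ and some $\omega_j\ge2$. Define the vector spaces $$R(n)^{\lambda/\mu}=L_{\lambda'/\mu'}(V_n)/L_{\lambda'/\mu'}(V_n)'',\qquad R(n)_{\lambda/\mu}=K_{\lambda/\mu}(V_n)/K_{\lambda/\mu}(V_n)'',$$ and, for any $N\ge r$, the skew Specht module $S^{\lambda/\mu}=L_{\lambda'/\mu'}(V_N)^{(1^r,0^{N-r})}$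 and the dual skew Specht module $S_{\lambda/\mu}=K_{\lambda/\mu}(V_N)^{(1^r,0^{N-r})}$. **Basis theorem.** 1. The classes of the elements $d_{\lambda'/\mu'}(V_n)(X_T)$, where $T$ runs over the semistandard tableaux of shape $\lambda'/\mu'$ with distinct entries from $[n]$, form a basis of $R(n)^{\lambda/\mu}$ (indexed by these $T$). 2. The classes of the elements $d'_{\lambda/\mu}(V_n)(Y_T)$, where $T$ runs over the semistandard tableaux of shape $\lambda/\mu$ with distinct entries from $[n]$, form a basis of $R(n)_{\lambda/\mu}$ (indexed by these $T$). 3. For every $N\ge r$, $\dim R(n)^{\lambda/\mu}=\binom nr\dim S^{\lambda/\mu}$ and $\dim R(n)_{\lambda/\mu}=\binom nr\dim S_{\lambda/\mu}$. -/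

import Mathlib

noncomputable section

namespace SchurWeyl

open scoped TensorProduct
open Module

/-! ### Symmetric and divided powers -/

section Powers

variable (𝕜 : Type*) [Field 𝕜]

/-- `Sym_m(W)`, the degree `m` component of the symmetric algebra of `W`. -/
def symPower (W : Type*) [AddCommGroup W] [Module 𝕜 W] (m : ℕ) :
    Submodule 𝕜 (SymmetricAlgebra 𝕜 W) :=
  LinearMap.range (SymmetricAlgebra.ι 𝕜 W) ^ m

theorem prod_ι_mem_symPower (W : Type*) [AddCommGroup W] [Module 𝕜 W] (m : ℕ) (w : Fin m → W) :
    (∏ k, SymmetricAlgebra.ι 𝕜 W (w k)) ∈ symPower 𝕜 W m := by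
  induction m with
  | zero => simp [symPower]
  | succ m ih =>
    rw [Fin.prod_univ_succ, symPower, pow_succ']
    exact Submodule.mul_mem_mul ⟨_, rfl⟩ (ih _)

/-- The multiplication map `W ⊗ ⋯ ⊗ W → Sym_m(W)`. -/
def symMul (W : Type*) [AddCommGroup W] [Module 𝕜 W] (m : ℕ) :
    (⨂[𝕜]^m W) →ₗ[𝕜] symPower 𝕜 W m :=
  PiTensorProduct.lift
    (((MultilinearMap.mkPiAlgebra 𝕜 (Fin m) (SymmetricAlgebra 𝕜 W)).compLinearMap
      fun _ => SymmetricAlgebra.ι 𝕜 W).codRestrict (symPower 𝕜 W m)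
        (fun w => prod_ι_mem_symPower 𝕜 W m w))

/-- The algebra map `Sym(W) → Sym(W')` induced by a linear map. -/
def symAlgMap {W W' : Type*} [AddCommGroup W] [Module 𝕜 W] [AddCommGroup W'] [Module 𝕜 W']
    (g : W →ₗ[𝕜] W') : SymmetricAlgebra 𝕜 W →ₐ[𝕜] SymmetricAlgebra 𝕜 W' :=
  SymmetricAlgebra.lift (SymmetricAlgebra.ι 𝕜 W' ∘ₗ g)

variable (V : Type*) [AddCommGroup V] [Module 𝕜 V]

/-- The divided power `D_m(V)`, the dual of `Sym_m(V^*)`. -/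
abbrev DividedPower (m : ℕ) : Type _ := Dual 𝕜 (symPower 𝕜 (Dual 𝕜 V) m)

/-- The canonical isomorphism `V ⊗ ⋯ ⊗ V ≃ (V^* ⊗ ⋯ ⊗ V^*)^*`. -/
def tensorEquivDual [FiniteDimensional 𝕜 V] (m : ℕ) :
    (⨂[𝕜]^m V) ≃ₗ[𝕜] Dual 𝕜 (⨂[𝕜]^m (Dual 𝕜 V)) :=
  (PiTensorProduct.congr fun _ : Fin m => evalEquiv 𝕜 V).trans
    (PiTensorProduct.dualDistribEquiv (R := 𝕜) (M := fun _ : Fin m => Dual 𝕜 V))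

/-- The iterated comultiplication `D_m(V) → V ⊗ ⋯ ⊗ V`, which is dual to the multiplication
`V^* ⊗ ⋯ ⊗ V^* → Sym_m(V^*)`. -/
def dividedToTensor [FiniteDimensional 𝕜 V] (m : ℕ) :
    DividedPower 𝕜 V m →ₗ[𝕜] ⨂[𝕜]^m V :=
  (tensorEquivDual 𝕜 V m).symm.toLinearMap ∘ₗ (symMul 𝕜 (Dual 𝕜 V) m).dualMap

variable {V}

/-- For a basis `b` of `V` the element `b_1^{(a_1)} ⋯ b_n^{(a_n)}` of `D_m(V)`, where
`m = a_1 + ⋯ + a_n`: the functional on `Sym_m(V^*)` whose value at a polynomial in the dual basis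
`b_1^*, …, b_n^*` is the coefficient of the monomial `(b_1^*)^{a_1} ⋯ (b_n^*)^{a_n}`. -/
def dividedMonomial {n : ℕ} (b : Basis (Fin n) 𝕜 V) (m : ℕ) (a : Fin n →₀ ℕ) :
    DividedPower 𝕜 V m :=
  MvPolynomial.lcoeff 𝕜 a ∘ₗ
    (SymmetricAlgebra.equivMvPolynomial b.dualBasis).toLinearMap ∘ₗ (symPower 𝕜 (Dual 𝕜 V) m).subtype

end Powers

/-! ### Skew shapes and tableaux

A partition is a Young diagram; rows and columns are numbered from `0`, and `(i, j)` is the cell in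
row `i` and column `j`. A skew partition is a pair `mu ≤ lam`. -/

/-- The cells of the skew diagram `lam / mu`. -/
abbrev SkewCell (lam mu : YoungDiagram) : Type := {c : ℕ × ℕ // c ∈ lam ∧ c ∉ mu}

/-- The length of row `i` of `lam / mu`. -/
abbrev skewRowLen (lam mu : YoungDiagram) (i : ℕ) : ℕ := lam.rowLen i - mu.rowLen i

/-- The `k`-th cell of row `i` of `lam / mu`. -/
def rowCell (lam mu : YoungDiagram) (i : ℕ) (k : Fin (skewRowLen lam mu i)) : SkewCell lam mu :=
  ⟨(i, mu.rowLen i + k), by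
    have := k.2
    rw [YoungDiagram.mem_iff_lt_rowLen, YoungDiagram.mem_iff_lt_rowLen]
    unfold skewRowLen at this
    omega⟩

/-- The column of the `k`-th cell of row `i` of `lam / mu`. -/
def rowCol (lam mu : YoungDiagram) (i : ℕ) (k : Fin (skewRowLen lam mu i)) : Fin (lam.rowLen 0) :=
  ⟨mu.rowLen i + k, by
    have := k.2
    have := lam.rowLen_anti 0 i (Nat.zero_le _)
    unfold skewRowLen at *
    omega⟩

/-- A semistandard tableau of shape `lam / mu` with entries in `[n]` that are distinct: entries
increase strictly along the rows and weakly down the columns. -/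
@[ext]
structure DistinctTableau (lam mu : YoungDiagram) (n : ℕ) where
  entry : SkewCell lam mu → Fin n
  row_strict : ∀ c d : SkewCell lam mu, c.1.1 = d.1.1 → c.1.2 < d.1.2 → entry c < entry d
  col_weak : ∀ c d : SkewCell lam mu, c.1.2 = d.1.2 → c.1.1 < d.1.1 → entry c ≤ entry d
  distinct : Function.Injective entry

/-! ### Schur modules and Weyl modules -/

section Modules

variable {𝕜 : Type*} [Field 𝕜] {V : Type*} [AddCommGroup V] [Module 𝕜 V]
variable {B : Type*} [Ring B] [Algebra 𝕜 B]

/-- For `ι : V → B`, the map `V ⊗ ⋯ ⊗ V → B ⊗ ⋯ ⊗ B` (with `c` factors `B`, one for each column)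
that puts the `k`-th factor into the column `col k`. -/
def placeRow (ι : V →ₗ[𝕜] B) {a c : ℕ} (col : Fin a → Fin c) :
    (⨂[𝕜]^a V) →ₗ[𝕜] ⨂[𝕜] (_ : Fin c), B :=
  PiTensorProduct.lift
    ((MultilinearMap.mkPiAlgebraFin 𝕜 a (⨂[𝕜] (_ : Fin c), B)).compLinearMap fun k =>
      (PiTensorProduct.singleAlgHom (R := 𝕜) (A := fun _ : Fin c => B) (col k)).toLinearMap ∘ₗ ι)

/-- The map `⨂_i V^{⊗ a_i} → ⨂_j B` that puts the `k`-th factor of row `i` into column `col i k` and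
multiplies, in each column, from top to bottom. -/
def placeRows (ι : V →ₗ[𝕜] B) {q c : ℕ} (a : Fin q → ℕ) (col : ∀ i, Fin (a i) → Fin c) :
    (⨂[𝕜] i : Fin q, ⨂[𝕜]^(a i) V) →ₗ[𝕜] ⨂[𝕜] (_ : Fin c), B :=
  PiTensorProduct.lift
    ((MultilinearMap.mkPiAlgebraFin 𝕜 q (⨂[𝕜] (_ : Fin c), B)).compLinearMap fun i =>
      placeRow ι (col i))

variable (𝕜 V)

/-- `Λ^{lam/mu}(V)`, the tensor product over the rows of `lam / mu` of exterior powers. -/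
abbrev ExtRows (lam mu : YoungDiagram) : Type _ :=
  ⨂[𝕜] i : Fin (lam.colLen 0), ⋀[𝕜]^(skewRowLen lam mu i) V

/-- `D_{lam/mu}(V)`, the tensor product over the rows of `lam / mu` of divided powers. -/
abbrev DivRows (lam mu : YoungDiagram) : Type _ :=
  ⨂[𝕜] i : Fin (lam.colLen 0), DividedPower 𝕜 V (skewRowLen lam mu i)

/-- The tensor product over the columns of symmetric algebras; `Sym_{lam'/mu'}(V)` is the
component of it whose degree in each column is the length of that column. -/
abbrev SymCols (lam : YoungDiagram) : Type _ :=
  ⨂[𝕜] (_ : Fin (lam.rowLen 0)), SymmetricAlgebra 𝕜 V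

/-- The tensor product over the columns of exterior algebras; `Λ^{lam'/mu'}(V)` is the
component of it whose degree in each column is the length of that column. -/
abbrev ExtCols (lam : YoungDiagram) : Type _ :=
  ⨂[𝕜] (_ : Fin (lam.rowLen 0)), ExteriorAlgebra 𝕜 V

/-- The map `d_{lam/mu}(V) : Λ^{lam/mu}(V) → Sym_{lam'/mu'}(V)`: comultiply each row
`Λ^{a_i}(V) → V ⊗ ⋯ ⊗ V`, one factor for each cell, then multiply in `Sym(V)` along the columns. -/
def schurMap (lam mu : YoungDiagram) : ExtRows 𝕜 V lam mu →ₗ[𝕜] SymCols 𝕜 V lam :=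
  placeRows (SymmetricAlgebra.ι 𝕜 V) (fun i : Fin (lam.colLen 0) => skewRowLen lam mu i)
      (fun i => rowCol lam mu i) ∘ₗ
    PiTensorProduct.map fun i : Fin (lam.colLen 0) =>
      exteriorPower.toTensorPower 𝕜 V (skewRowLen lam mu i)

/-- The map `d'_{lam/mu}(V) : D_{lam/mu}(V) → Λ^{lam'/mu'}(V)`: comultiply each row
`D_{a_i}(V) → V ⊗ ⋯ ⊗ V`, one factor for each cell, then multiply in `Λ(V)` along the columns. -/
def weylMap [FiniteDimensional 𝕜 V] (lam mu : YoungDiagram) :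
    DivRows 𝕜 V lam mu →ₗ[𝕜] ExtCols 𝕜 V lam :=
  placeRows (ExteriorAlgebra.ι 𝕜) (fun i : Fin (lam.colLen 0) => skewRowLen lam mu i)
      (fun i => rowCol lam mu i) ∘ₗ
    PiTensorProduct.map fun i : Fin (lam.colLen 0) =>
      dividedToTensor 𝕜 V (skewRowLen lam mu i)

/-- The Schur module `L_{lam/mu}(V)`. -/
def schurModule (lam mu : YoungDiagram) : Submodule 𝕜 (SymCols 𝕜 V lam) :=
  LinearMap.range (schurMap 𝕜 V lam mu)

/-- The Weyl module `K_{lam/mu}(V)`. -/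
def weylModule [FiniteDimensional 𝕜 V] (lam mu : YoungDiagram) :
    Submodule 𝕜 (ExtCols 𝕜 V lam) :=
  LinearMap.range (weylMap 𝕜 V lam mu)

variable {V}

/-- The element `X_T` of `Λ^{lam/mu}(V)`: the tensor product over the rows of the exterior products
of the basis vectors indexed by the entries of the row. -/
def elemX {n : ℕ} (b : Basis (Fin n) 𝕜 V) (lam mu : YoungDiagram)
    (T : SkewCell lam mu → Fin n) : ExtRows 𝕜 V lam mu :=
  PiTensorProduct.tprod 𝕜 fun i : Fin (lam.colLen 0) =>
    exteriorPower.ιMulti 𝕜 (skewRowLen lam mu i) fun k => b (T (rowCell lam mu i k))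

/-- The element `Y_T` of `D_{lam/mu}(V)`: the tensor product over the rows `i` of
`b_1^{(a_{i1})} ⋯ b_n^{(a_{in})}`, where `a_{ij}` is the number of entries `j` in row `i`. -/
def elemY {n : ℕ} (b : Basis (Fin n) 𝕜 V) (lam mu : YoungDiagram)
    (T : SkewCell lam mu → Fin n) : DivRows 𝕜 V lam mu :=
  PiTensorProduct.tprod 𝕜 fun i : Fin (lam.colLen 0) =>
    dividedMonomial 𝕜 b (skewRowLen lam mu i)
      (∑ k : Fin (skewRowLen lam mu i), Finsupp.single (T (rowCell lam mu i k)) 1)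

end Modules

/-! ### The action of matrices on `L_{lam/mu}(V_n)` and `K_{lam/mu}(V_n)` -/

section Action

variable {𝕜 : Type*} [Field 𝕜] {V : Type*} [AddCommGroup V] [Module 𝕜 V]
variable {B : Type*} [Ring B] [Algebra 𝕜 B]

theorem map_algHom_mul {c : ℕ} (F : B →ₐ[𝕜] B) (x y : ⨂[𝕜] (_ : Fin c), B) :
    PiTensorProduct.map (fun _ => F.toLinearMap) (x * y) =
      PiTensorProduct.map (fun _ => F.toLinearMap) x *
        PiTensorProduct.map (fun _ => F.toLinearMap) y := by
  induction x using PiTensorProduct.induction_on with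
  | smul_tprod r x =>
    rw [smul_mul_assoc, map_smul, map_smul, smul_mul_assoc]
    congr 1
    induction y using PiTensorProduct.induction_on with
    | smul_tprod s y =>
      rw [mul_smul_comm, map_smul, map_smul, mul_smul_comm, PiTensorProduct.tprod_mul_tprod,
        PiTensorProduct.map_tprod, PiTensorProduct.map_tprod, PiTensorProduct.map_tprod,
        PiTensorProduct.tprod_mul_tprod]
      congr 2
      funext i
      simp
    | add y z hy hz => rw [mul_add, map_add, map_add, mul_add, hy, hz]
  | add y z hy hz => rw [add_mul, map_add, map_add, add_mul, hy, hz]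

/-- An endomorphism of the algebra `B` acting on all factors of `B ⊗ ⋯ ⊗ B`. -/
def tensorAlgHom (c : ℕ) (F : B →ₐ[𝕜] B) :
    (⨂[𝕜] (_ : Fin c), B) →ₐ[𝕜] ⨂[𝕜] (_ : Fin c), B :=
  AlgHom.ofLinearMap (PiTensorProduct.map fun _ => F.toLinearMap)
    (by simp [PiTensorProduct.one_def]; rfl) (map_algHom_mul F)

theorem tensorAlgHom_tprod (c : ℕ) (F : B →ₐ[𝕜] B) (x : Fin c → B) :
    tensorAlgHom c F (PiTensorProduct.tprod 𝕜 x) = PiTensorProduct.tprod 𝕜 fun j => F (x j) :=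
  PiTensorProduct.map_tprod _ _

theorem tensorAlgHom_one (c : ℕ) : tensorAlgHom (𝕜 := 𝕜) c (AlgHom.id 𝕜 B) = AlgHom.id 𝕜 _ := by
  apply AlgHom.toLinearMap_injective
  apply PiTensorProduct.ext
  ext x
  exact tensorAlgHom_tprod _ _ _

theorem tensorAlgHom_comp (c : ℕ) (F G : B →ₐ[𝕜] B) :
    tensorAlgHom c (F.comp G) = (tensorAlgHom c F).comp (tensorAlgHom c G) := by
  apply AlgHom.toLinearMap_injective
  apply PiTensorProduct.ext
  ext x
  simp only [LinearMap.compMultilinearMap_apply, AlgHom.toLinearMap_apply, AlgHom.comp_apply,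
    tensorAlgHom_tprod]

theorem placeRow_map (ι : V →ₗ[𝕜] B) (f : V →ₗ[𝕜] V) (F : B →ₐ[𝕜] B)
    (h : ∀ v, F (ι v) = ι (f v)) {a c : ℕ} (col : Fin a → Fin c) (x : ⨂[𝕜]^a V) :
    tensorAlgHom c F (placeRow ι col x) = placeRow ι col (PiTensorProduct.map (fun _ => f) x) := by
  suffices H : (tensorAlgHom c F).toLinearMap ∘ₗ placeRow ι col =
      placeRow ι col ∘ₗ PiTensorProduct.map (fun _ => f) from LinearMap.congr_fun H x
  apply PiTensorProduct.ext
  ext v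
  simp only [LinearMap.compMultilinearMap_apply, LinearMap.comp_apply, PiTensorProduct.map_tprod,
    placeRow, PiTensorProduct.lift.tprod, MultilinearMap.compLinearMap_apply,
    MultilinearMap.mkPiAlgebraFin_apply, AlgHom.toLinearMap_apply, map_list_prod, List.map_ofFn]
  congr 2
  funext k
  simp only [Function.comp_apply, PiTensorProduct.singleAlgHom_apply, tensorAlgHom_tprod]
  congr 1
  funext j
  by_cases hj : j = col k
  · subst hj; simp [h]
  · simp [hj]

theorem placeRows_map (ι : V →ₗ[𝕜] B) (f : V →ₗ[𝕜] V) (F : B →ₐ[𝕜] B)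
    (h : ∀ v, F (ι v) = ι (f v)) {q c : ℕ} (a : Fin q → ℕ) (col : ∀ i, Fin (a i) → Fin c)
    (x : ⨂[𝕜] i : Fin q, ⨂[𝕜]^(a i) V) :
    tensorAlgHom c F (placeRows ι a col x) =
      placeRows ι a col (PiTensorProduct.map (fun _ => PiTensorProduct.map fun _ => f) x) := by
  suffices H : (tensorAlgHom c F).toLinearMap ∘ₗ placeRows ι a col =
      placeRows ι a col ∘ₗ PiTensorProduct.map (fun _ => PiTensorProduct.map fun _ => f) from
    LinearMap.congr_fun H x
  apply PiTensorProduct.ext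
  ext v
  simp only [LinearMap.compMultilinearMap_apply, LinearMap.comp_apply, PiTensorProduct.map_tprod,
    placeRows, PiTensorProduct.lift.tprod, MultilinearMap.compLinearMap_apply,
    MultilinearMap.mkPiAlgebraFin_apply, AlgHom.toLinearMap_apply, map_list_prod, List.map_ofFn]
  congr 2
  funext i
  exact placeRow_map ι f F h (col i) (v i)

theorem toTensorPower_map (f : V →ₗ[𝕜] V) (m : ℕ) :
    PiTensorProduct.map (fun _ => f) ∘ₗ exteriorPower.toTensorPower 𝕜 V m =
      exteriorPower.toTensorPower 𝕜 V m ∘ₗ exteriorPower.map m f := by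
  apply exteriorPower.linearMap_ext
  ext v
  simp [exteriorPower.toTensorPower_apply_ιMulti]

theorem symAlgMap_mem_symPower {W : Type*} [AddCommGroup W] [Module 𝕜 W] (g : W →ₗ[𝕜] W) (m : ℕ) :
    symPower 𝕜 W m ≤ (symPower 𝕜 W m).comap (symAlgMap 𝕜 g).toLinearMap := by
  rw [← Submodule.map_le_iff_le_comap, symPower, Submodule.map_pow]
  refine pow_le_pow_left' ?_ m
  rintro _ ⟨_, ⟨w, rfl⟩, rfl⟩
  exact ⟨g w, by simp [symAlgMap]⟩

theorem symMul_map {W : Type*} [AddCommGroup W] [Module 𝕜 W] (g : W →ₗ[𝕜] W) (m : ℕ) :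
    symMul 𝕜 W m ∘ₗ PiTensorProduct.map (fun _ => g) =
      (symAlgMap 𝕜 g).toLinearMap.restrict (symAlgMap_mem_symPower g m) ∘ₗ symMul 𝕜 W m := by
  apply PiTensorProduct.ext
  ext w
  simp only [symMul, symAlgMap, LinearMap.compMultilinearMap_apply, LinearMap.comp_apply,
    PiTensorProduct.map_tprod, PiTensorProduct.lift.tprod, LinearMap.coe_restrict_apply]
  change (∏ k, SymmetricAlgebra.ι 𝕜 W (g (w k))) =
    SymmetricAlgebra.lift _ (∏ k, SymmetricAlgebra.ι 𝕜 W (w k))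
  simp

theorem dividedToTensor_map [FiniteDimensional 𝕜 V] (f : V →ₗ[𝕜] V) (m : ℕ) :
    PiTensorProduct.map (fun _ => f) ∘ₗ dividedToTensor 𝕜 V m =
      dividedToTensor 𝕜 V m ∘ₗ
        ((symAlgMap 𝕜 f.dualMap).toLinearMap.restrict
          (symAlgMap_mem_symPower f.dualMap m)).dualMap := by
  have h1 : (tensorEquivDual 𝕜 V m).toLinearMap ∘ₗ PiTensorProduct.map (fun _ => f) =
      (PiTensorProduct.map (fun _ => f.dualMap)).dualMap ∘ₗ
        (tensorEquivDual 𝕜 V m).toLinearMap := by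
    apply PiTensorProduct.ext
    refine MultilinearMap.ext fun v => ?_
    apply PiTensorProduct.ext
    refine MultilinearMap.ext fun w => ?_
    simp [tensorEquivDual, PiTensorProduct.dualDistribEquiv,
      PiTensorProduct.dualDistribEquivOfBasis]
  refine LinearMap.ext fun φ => ?_
  apply (tensorEquivDual 𝕜 V m).injective
  have h2 := LinearMap.congr_fun h1 (dividedToTensor 𝕜 V m φ)
  simp only [LinearMap.comp_apply, LinearEquiv.coe_coe] at h2 ⊢
  rw [h2]
  simp only [dividedToTensor, LinearMap.comp_apply, LinearEquiv.coe_coe,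
    LinearEquiv.apply_symm_apply]
  rw [← LinearMap.comp_apply, LinearMap.dualMap_comp_dualMap, symMul_map]
  rfl

variable (𝕜) (n : ℕ)

/-- The action of `n × n` matrices on `Sym(V_n) ⊗ ⋯ ⊗ Sym(V_n)`, where `V_n` is the space of column
vectors. -/
def symColsRep (lam : YoungDiagram) :
    Representation 𝕜 (Matrix (Fin n) (Fin n) 𝕜) (SymCols 𝕜 (Fin n → 𝕜) lam) where
  toFun A := (tensorAlgHom (lam.rowLen 0) (symAlgMap 𝕜 A.toLin')).toLinearMap
  map_one' := by
    have : symAlgMap 𝕜 (Matrix.toLin' (1 : Matrix (Fin n) (Fin n) 𝕜)) = AlgHom.id 𝕜 _ := by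
      apply SymmetricAlgebra.algHom_ext
      ext v
      simp [symAlgMap]
    rw [this, tensorAlgHom_one]
    rfl
  map_mul' A A' := by
    have : symAlgMap 𝕜 (A * A').toLin' =
        (symAlgMap 𝕜 A.toLin').comp (symAlgMap 𝕜 A'.toLin') := by
      apply SymmetricAlgebra.algHom_ext
      ext v
      simp [symAlgMap]
    rw [this, tensorAlgHom_comp]
    rfl

/-- The action of `n × n` matrices on `Λ(V_n) ⊗ ⋯ ⊗ Λ(V_n)`. -/
def extColsRep (lam : YoungDiagram) :
    Representation 𝕜 (Matrix (Fin n) (Fin n) 𝕜) (ExtCols 𝕜 (Fin n → 𝕜) lam) where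
  toFun A := (tensorAlgHom (lam.rowLen 0) (ExteriorAlgebra.map A.toLin')).toLinearMap
  map_one' := by
    rw [Matrix.toLin'_one, ExteriorAlgebra.map_id, tensorAlgHom_one]
    rfl
  map_mul' A A' := by
    rw [Matrix.toLin'_mul, ← ExteriorAlgebra.map_comp_map, tensorAlgHom_comp]
    rfl

theorem schurModule_stable (lam mu : YoungDiagram) (A : Matrix (Fin n) (Fin n) 𝕜) :
    schurModule 𝕜 (Fin n → 𝕜) lam mu ≤
      (schurModule 𝕜 (Fin n → 𝕜) lam mu).comap (symColsRep 𝕜 n lam A) := by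
  rintro _ ⟨x, rfl⟩
  refine ⟨PiTensorProduct.map (fun i => exteriorPower.map _ A.toLin') x, ?_⟩
  simp only [schurMap, symColsRep, LinearMap.comp_apply, MonoidHom.coe_mk, OneHom.coe_mk,
    AlgHom.toLinearMap_apply]
  rw [placeRows_map _ A.toLin' _ (fun v => by simp [symAlgMap])]
  congr 1
  rw [← LinearMap.comp_apply, ← LinearMap.comp_apply, ← PiTensorProduct.map_comp,
    ← PiTensorProduct.map_comp]
  simp only [toTensorPower_map]

theorem weylModule_stable (lam mu : YoungDiagram) (A : Matrix (Fin n) (Fin n) 𝕜) :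
    weylModule 𝕜 (Fin n → 𝕜) lam mu ≤
      (weylModule 𝕜 (Fin n → 𝕜) lam mu).comap (extColsRep 𝕜 n lam A) := by
  rintro _ ⟨x, rfl⟩
  refine ⟨PiTensorProduct.map (fun i =>
    ((symAlgMap 𝕜 A.toLin'.dualMap).toLinearMap.restrict
      (symAlgMap_mem_symPower A.toLin'.dualMap _)).dualMap) x, ?_⟩
  simp only [weylMap, extColsRep, LinearMap.comp_apply, MonoidHom.coe_mk, OneHom.coe_mk,
    AlgHom.toLinearMap_apply]
  rw [placeRows_map _ A.toLin' _ (fun v => by simp)]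
  congr 1
  rw [← LinearMap.comp_apply, ← LinearMap.comp_apply, ← PiTensorProduct.map_comp,
    ← PiTensorProduct.map_comp]
  simp only [dividedToTensor_map]

/-- `L_{lam/mu}(V_n)` as a representation of the monoid of `n × n` matrices. -/
def schurRep (lam mu : YoungDiagram) :
    Representation 𝕜 (Matrix (Fin n) (Fin n) 𝕜) (schurModule 𝕜 (Fin n → 𝕜) lam mu) :=
  (symColsRep 𝕜 n lam).subrepresentation _ (schurModule_stable 𝕜 n lam mu)

/-- `K_{lam/mu}(V_n)` as a representation of the monoid of `n × n` matrices. -/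
def weylRep (lam mu : YoungDiagram) :
    Representation 𝕜 (Matrix (Fin n) (Fin n) 𝕜) (weylModule 𝕜 (Fin n → 𝕜) lam mu) :=
  (extColsRep 𝕜 n lam).subrepresentation _ (weylModule_stable 𝕜 n lam mu)

end Action

/-! ### Weight spaces, the Schur functor and the symmetrized Schur functor -/

section Weights

variable {𝕜 : Type*} [Field 𝕜] {n : ℕ} {M : Type*} [AddCommGroup M] [Module 𝕜 M]

/-- The weight space `M^α`: the vectors `v` with `diag(t_1, …, t_n) v = t_1^{α_1} ⋯ t_n^{α_n} v` for
all invertible diagonal matrices. -/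
def weightSpace (ρ : Representation 𝕜 (Matrix (Fin n) (Fin n) 𝕜) M) (α : Fin n → ℕ) :
    Submodule 𝕜 M where
  carrier := {v | ∀ t : Fin n → 𝕜ˣ,
    ρ (Matrix.diagonal fun i => (t i : 𝕜)) v = (∏ i, (t i : 𝕜) ^ α i) • v}
  zero_mem' t := by simp
  add_mem' hv hw t := by rw [map_add, hv t, hw t, smul_add]
  smul_mem' c v hv t := by rw [map_smul, hv t, smul_comm]

/-- For `M` of degree `r`, the sum `M''` of the weight spaces `M^α` over the weights
`α = (α_1, …, α_n)` with `α_1 + ⋯ + α_n = r` and `α_j ≥ 2` for some `j`. -/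
def nonSquareFree (ρ : Representation 𝕜 (Matrix (Fin n) (Fin n) 𝕜) M) (r : ℕ) :
    Submodule 𝕜 M :=
  ⨆ α ∈ {α : Fin n → ℕ | ∑ i, α i = r ∧ ∃ j, 2 ≤ α j}, weightSpace ρ α

/-- The vector space `M / M''` underlying the value at `M` of the symmetrized Schur functor. -/
abbrev SymmetrizedSchur (ρ : Representation 𝕜 (Matrix (Fin n) (Fin n) 𝕜) M) (r : ℕ) : Type _ :=
  M ⧸ nonSquareFree ρ r

/-- The value `M^{(1^r, 0^{n-r})}` at `M` of the Schur functor (for `r ≤ n`). -/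
def schurFunctor (ρ : Representation 𝕜 (Matrix (Fin n) (Fin n) 𝕜) M) (r : ℕ) : Submodule 𝕜 M :=
  weightSpace ρ fun i => if (i : ℕ) < r then 1 else 0

variable (𝕜) (n)

/-- The vector space `R(n)^{lam/mu}`, for `lam / mu` of size `r`. -/
abbrev UpperR (lam mu : YoungDiagram) (r : ℕ) : Type _ :=
  SymmetrizedSchur (M := schurModule 𝕜 (Fin n → 𝕜) lam.transpose mu.transpose)
    (schurRep 𝕜 n lam.transpose mu.transpose) r

/-- The vector space `R(n)_{lam/mu}`, for `lam / mu` of size `r`. -/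
abbrev LowerR (lam mu : YoungDiagram) (r : ℕ) : Type _ :=
  SymmetrizedSchur (weylRep 𝕜 n lam mu) r

/-- The skew Specht module `S^{lam/mu}`, for `lam / mu` of size `r ≤ n`, formed inside
`L_{lam'/mu'}(V_n)`. -/
def skewSpecht (lam mu : YoungDiagram) (r : ℕ) :
    Submodule 𝕜 (schurModule 𝕜 (Fin n → 𝕜) lam.transpose mu.transpose) :=
  schurFunctor (M := schurModule 𝕜 (Fin n → 𝕜) lam.transpose mu.transpose)
    (schurRep 𝕜 n lam.transpose mu.transpose) r

/-- The dual skew Specht module `S_{lam/mu}`, for `lam / mu` of size `r ≤ n`, formed inside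
`K_{lam/mu}(V_n)`. -/
def dualSkewSpecht (lam mu : YoungDiagram) (r : ℕ) :
    Submodule 𝕜 (weylModule 𝕜 (Fin n → 𝕜) lam mu) :=
  schurFunctor (weylRep 𝕜 n lam mu) r

/-- The class of `d_{lam'/mu'}(V_n)(X_T)` in `R(n)^{lam/mu}`, for `T` of shape `lam'/mu'`. -/
def upperClass (lam mu : YoungDiagram) (r : ℕ)
    (T : SkewCell lam.transpose mu.transpose → Fin n) : UpperR 𝕜 n lam mu r :=
  (nonSquareFree (M := schurModule 𝕜 (Fin n → 𝕜) lam.transpose mu.transpose)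
    (schurRep 𝕜 n lam.transpose mu.transpose) r).mkQ
    ⟨schurMap 𝕜 (Fin n → 𝕜) lam.transpose mu.transpose
      (elemX 𝕜 (Pi.basisFun 𝕜 (Fin n)) lam.transpose mu.transpose T), LinearMap.mem_range_self _ _⟩

/-- The class of `d'_{lam/mu}(V_n)(Y_T)` in `R(n)_{lam/mu}`, for `T` of shape `lam/mu`. -/
def lowerClass (lam mu : YoungDiagram) (r : ℕ)
    (T : SkewCell lam mu → Fin n) : LowerR 𝕜 n lam mu r :=
  (nonSquareFree (weylRep 𝕜 n lam mu) r).mkQ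
    ⟨weylMap 𝕜 (Fin n → 𝕜) lam mu (elemY 𝕜 (Pi.basisFun 𝕜 (Fin n)) lam mu T),
      LinearMap.mem_range_self _ _⟩

end Weights

end SchurWeyl

end

/-!
The Schur module `L_{α/β}(V)` and the Weyl module `K_{α/β}(V)` are treated by one argument. Write
`B` for the symmetric algebra in the first case and for the exterior algebra in the second, and
`ε = 1` or `ε = -1` for the sign with which vectors commute in `B`. For a filling `w` of the cells
with numbers from `[n]` let `[w]` in `B ⊗ ⋯ ⊗ B` be the product of the basis vectors `e_{w(c)}`,
each placed in the factor of the column of `c` (`bracket`). If `T` has distinct entries, then the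
image `x_T` of `X_T` or `Y_T` is the row sum `∑ χ(ρ) [T ∘ ρ]` over the permutations `ρ` of the cells
that preserve the rows, where `χ` is the sign character in the first case and trivial in the second
(`schurMap_rowsX`, `weylMap_rowsY`). In both cases exchanging two cells `c ≠ d` of a column
multiplies `[w]` by `ε = -χ(c d)` (`bracket_swap`).

*Straightening.* A set of cells which, however the rows are rearranged, meets some column twice
gives a Garnir relation (`garnir`): the signed sum of the `[T ∘ g]` over all products `g` of a
permutation of this set and a row preserving one vanishes, because its terms cancel in pairs. If
the entries in a column decrease from a cell `c` to a lower cell `d`, then the cells to the right of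
`c` and to the left of `d` form such a set by the pigeonhole principle (`exists_same_col`), and the
relation expresses `x_T` by fillings with the same entries in which large entries have moved down.
Hence `x_T` is a combination of the `x_S` with `S` standard and with the entries of `T`
(`rowSum_mem_span_standard`).

*Independence.* For a standard `T`, the tensor product over the columns of the coefficients of the
monomials of the columns of `T` (`colFunctional`) vanishes on all `[w]` except those for which `w`
arises from `T` by permuting the columns. It takes the value `1` at `x_T`, and at `x_S`, for `S`
standard and different from `T`, it is nonzero only if `S` has smaller measure than `T`, where the
measure `colMeasure` is the least, among all rearrangements of the rows of a standard filling, at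
the filling itself (`eq_or_colMeasure_lt`). So the functionals are triangular on the `x_T`; they
also vanish on all `x_S` for which `S` has a repeated entry.

*Weights.* Each `x_T` is a weight vector whose weight is the content of `T`, and these vectors span
the module. As `𝕜` is infinite, the characters `t ↦ t^ω` are distinct, hence linearly independent,
and each weight space is spanned by the `x_T` of its weight (`weightSpace_le_span`). Therefore `M''`
is spanned by the `x_T` with a repeated entry, the classes of the `x_T` with `T` standard form a
basis of `M / M''` (`StandardSystem.basis`), and the `x_T` with `T` standard and entries in `[r]`
form a basis of the weight space of `(1^r, 0^{N-r})`. A standard filling with entries in `[n]` is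
the set of its `r` entries together with a standard filling with entries in `[r]`, which gives the
dimension formulas (`card_isStandard`).
-/

noncomputable section

namespace SchurWeyl

open scoped TensorProduct
open Module

/-! ### Permutations of the cells and the straightening of fillings -/

section Combinatorics

open Equiv Finset

variable {C : Type*}

/-- If `S` is stable under right multiplication by a subgroup `H` and the sum of `f` over each left
coset of `H` in `S` lies in `U`, then so does the sum of `f` over `S`. -/
theorem sum_mem_of_sum_coset_mem {G W R : Type*} [Group G] [DecidableEq G] [Ring R]
    [AddCommGroup W] [Module R W] (H : Subgroup G) [Fintype H] (S : Finset G)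
    (hS : ∀ g ∈ S, ∀ h ∈ H, g * h ∈ S) (f : G → W) (U : Submodule R W)
    (hU : ∀ g ∈ S, ∑ h : H, f (g * h) ∈ U) : ∑ g ∈ S, f g ∈ U := by
  classical
  rw [← Finset.sum_fiberwise_of_maps_to (t := S.image (QuotientGroup.mk (s := H)))
    (g := QuotientGroup.mk (s := H)) (fun g hg => Finset.mem_image_of_mem _ hg)]
  refine Submodule.sum_mem _ fun q hq => ?_
  obtain ⟨g, hg, rfl⟩ := Finset.mem_image.1 hq
  convert hU g hg using 1
  refine (Finset.sum_bij (fun (h : H) _ => g * h) ?_ ?_ ?_ ?_).symm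
  · intro h _
    simp [hS g hg h h.2]
  · intro h _ h' _ e
    exact Subtype.ext (mul_left_cancel e)
  · intro g' hg'
    obtain ⟨hg', e⟩ := Finset.mem_filter.1 hg'
    exact ⟨⟨g⁻¹ * g', QuotientGroup.eq.1 e.symm⟩, Finset.mem_univ _, by simp⟩
  · intro h _
    rfl

/-- A rearrangement inequality: if `f` drops along `σ` only where `T ≥ θ` and rises only where
`T ≤ θ`, then permuting by `σ` decreases `∑ f T`. -/
theorem sum_comp_perm_mul_lt [Fintype C] (f T : C → ℤ) (θ : ℤ) (σ : Perm C)
    (h : ∀ x, 0 ≤ (f x - f (σ x)) * (T x - θ)) (h' : ∃ x, 0 < (f x - f (σ x)) * (T x - θ)) :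
    ∑ x, f (σ x) * T x < ∑ x, f x * T x := by
  have h1 : 0 < ∑ x, (f x - f (σ x)) * (T x - θ) :=
    Finset.sum_pos' (fun x _ => h x) (by simpa using h')
  have h2 : ∑ x, f (σ x) = ∑ x, f x := Equiv.sum_comp σ f
  have h3 : ∑ x, (f x - f (σ x)) * (T x - θ) =
      ∑ x, f x * T x - ∑ x, f (σ x) * T x - θ * (∑ x, f x - ∑ x, f (σ x)) := by
    rw [← Finset.sum_sub_distrib, ← Finset.sum_sub_distrib, Finset.mul_sum,
      ← Finset.sum_sub_distrib]
    exact Finset.sum_congr rfl fun x _ => by ring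
  rw [h3, h2] at h1
  linarith

/-- The permutations of the cells that preserve a labelling of the cells, such as the number of
the row or of the column. -/
def labelGroup (row : C → ℕ) : Subgroup (Perm C) where
  carrier := {σ | ∀ c, row (σ c) = row c}
  one_mem' _ := rfl
  mul_mem' {σ τ} hσ hτ c := (hσ (τ c)).trans (hτ c)
  inv_mem' {σ} hσ c := by
    have := hσ (σ⁻¹ c)
    simpa using this.symm

instance [Fintype C] (row : C → ℕ) : DecidablePred (· ∈ labelGroup row) := fun σ =>
  inferInstanceAs (Decidable (∀ c, row (σ c) = row c))

theorem swap_mem_labelGroup [DecidableEq C] {row : C → ℕ} {c d : C} (h : row c = row d) :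
    swap c d ∈ labelGroup row := by
  intro x
  by_cases hc : x = c
  · subst hc; simp [h]
  by_cases hd : x = d
  · subst hd; simp [h]
  rw [swap_apply_of_ne_of_ne hc hd]

variable {n : ℕ}

/-- Entries increase strictly from one cell to another with the same `row` and larger `col`. -/
def IncreasingAlong (row col : C → ℕ) (T : C → Fin n) : Prop :=
  ∀ c d, row c = row d → col c < col d → T c < T d

/-- The standard fillings: distinct entries that increase along the rows and down the columns. -/
def IsStandard (row col : C → ℕ) (T : C → Fin n) : Prop :=
  IncreasingAlong row col T ∧ IncreasingAlong col row T ∧ Function.Injective T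

theorem exists_inversion {row col : C → ℕ} {T : C → Fin n}
    (hT : Function.Injective T) (h : ¬ IncreasingAlong row col T) :
    ∃ c d, row c = row d ∧ col c < col d ∧ T d < T c := by
  unfold IncreasingAlong at h
  push Not at h
  obtain ⟨c, d, hr, hc, hle⟩ := h
  refine ⟨c, d, hr, hc, lt_of_le_of_ne hle fun e => ?_⟩
  rw [hT e] at hc
  exact lt_irrefl _ hc

variable [Fintype C]

/-- The sum of the entries weighted by the distance of their columns from column `B`; exchanging
two entries of a row that are in the wrong order decreases it. With `row` in place of `col` it
measures how far the large entries are from the bottom. -/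
def colMeasure (B : ℕ) (col : C → ℕ) (T : C → Fin n) : ℕ := ∑ c, (B - col c) * (T c : ℕ)

theorem colMeasure_comp (B : ℕ) (col : C → ℕ) (T : C → Fin n) (σ : Perm C) :
    colMeasure B col (T ∘ σ) = ∑ c, (B - col (σ⁻¹ c)) * (T c : ℕ) := by
  rw [colMeasure, ← Equiv.sum_comp σ (fun c => (B - col (σ⁻¹ c)) * (T c : ℕ))]
  simp

theorem colMeasure_comp_of_mem (B : ℕ) {col : C → ℕ} (T : C → Fin n) {σ : Perm C}
    (h : σ ∈ labelGroup col) : colMeasure B col (T ∘ σ) = colMeasure B col T := by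
  rw [colMeasure_comp]
  exact Finset.sum_congr rfl fun c _ => by rw [(labelGroup col).inv_mem h c]

theorem colMeasure_comp_lt {B : ℕ} {col : C → ℕ} {T : C → Fin n} {σ : Perm C} (θ : Fin n)
    (hB : ∀ c, col c ≤ B)
    (h : ∀ x, (col x = col (σ⁻¹ x)) ∨ (col x < col (σ⁻¹ x) ∧ θ ≤ T x) ∨
      (col (σ⁻¹ x) < col x ∧ T x < θ)) (h' : ∃ x, col (σ⁻¹ x) < col x ∧ T x < θ) :
    colMeasure B col (T ∘ σ) < colMeasure B col T := by
  have key := sum_comp_perm_mul_lt (fun c => (B : ℤ) - col c) (fun c => (T c : ℤ)) θ σ⁻¹ ?_ ?_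
  · rw [colMeasure_comp, colMeasure]
    zify
    convert key using 2 with c _ c _
    · rw [Nat.cast_sub (hB _)]
    · rw [Nat.cast_sub (hB _)]
  · intro x
    rcases h x with h | ⟨h1, h2⟩ | ⟨h1, h2⟩
    · simp [h]
    · have h2' : ((θ : ℕ) : ℤ) ≤ (T x : ℕ) := by exact_mod_cast h2
      have h1' : (col x : ℤ) < col (σ⁻¹ x) := by exact_mod_cast h1
      exact mul_nonneg (by linarith) (by linarith)
    · have h2' : ((T x : ℕ) : ℤ) < (θ : ℕ) := by exact_mod_cast h2
      have h1' : (col (σ⁻¹ x) : ℤ) < col x := by exact_mod_cast h1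
      exact mul_nonneg_of_nonpos_of_nonpos (by linarith) (by linarith)
  · obtain ⟨x, h1, h2⟩ := h'
    refine ⟨x, ?_⟩
    have h2' : ((T x : ℕ) : ℤ) < (θ : ℕ) := by exact_mod_cast h2
    have h1' : (col (σ⁻¹ x) : ℤ) < col x := by exact_mod_cast h1
    exact mul_pos_of_neg_of_neg (by linarith) (by linarith)

variable [DecidableEq C]

theorem colMeasure_swap_lt {B : ℕ} {col : C → ℕ} {T : C → Fin n} (hB : ∀ c, col c ≤ B) {c d : C}
    (hcol : col c < col d) (hT : T d < T c) :
    colMeasure B col (T ∘ swap c d) < colMeasure B col T := by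
  refine colMeasure_comp_lt (T c) hB (fun x => ?_) ⟨d, by simpa using hcol, hT⟩
  rw [swap_inv]
  by_cases hc : x = c
  · subst hc; simp [hcol]
  by_cases hd : x = d
  · subst hd; simp [hcol, hT]
  simp [swap_apply_of_ne_of_ne hc hd]

/-- A row preserving permutation that preserves the order of the entries is trivial. -/
theorem eq_one_of_increasingAlong {row col : C → ℕ}
    (hinj : ∀ c d, row c = row d → col c = col d → c = d) {T : C → Fin n}
    (hT : IncreasingAlong row col T) {ρ : Perm C} (hρ : ρ ∈ labelGroup row)
    (hTρ : IncreasingAlong row col (T ∘ ρ)) : ρ = 1 := by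
  by_contra hne
  -- `ρ` would move the leftmost of the moved cells to the right, and some other cell to its place.
  obtain ⟨c, hc, hmin⟩ := Finset.exists_min_image (univ.filter fun c => ρ c ≠ c) col (by
    by_contra he
    refine hne (Equiv.ext fun c => ?_)
    by_contra hc
    exact he ⟨c, by simpa using hc⟩)
  simp only [mem_filter, mem_univ, true_and] at hc hmin
  have hmono : ∀ a b, row a = row b → col a < col b → col (ρ a) < col (ρ b) := by
    intro a b hab hlt
    have hr : row (ρ a) = row (ρ b) := by rw [hρ, hρ, hab]
    rcases lt_trichotomy (col (ρ a)) (col (ρ b)) with h | h | h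
    · exact h
    · have := ρ.injective (hinj _ _ hr h)
      subst this
      exact absurd hlt (lt_irrefl _)
    · exact absurd (hT _ _ hr.symm h) (not_lt.2 (hTρ a b hab hlt).le)
  have h1 : col c < col (ρ c) := lt_of_le_of_ne (hmin _ fun e => hc (ρ.injective e))
    fun e => hc (hinj _ _ (hρ c) e.symm)
  have hρ' := (labelGroup row).inv_mem hρ
  have hc' : ρ⁻¹ c ≠ c := fun e => hc (by conv_lhs => rw [← e]; simp)
  have h2 : col c < col (ρ⁻¹ c) :=
    lt_of_le_of_ne (hmin _ fun e => hc' (by simpa using e.symm))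
      fun e => hc' (hinj _ _ (hρ' c) e.symm)
  have h3 := hmono c (ρ⁻¹ c) (hρ' c).symm h2
  simp only [Perm.coe_inv, apply_symm_apply] at h3
  exact absurd h1 (not_lt.2 h3.le)

/-- Among the rearrangements of its rows, a filling with increasing rows has the least measure. -/
theorem colMeasure_lt_comp {B : ℕ} {row col : C → ℕ} (hB : ∀ c, col c ≤ B)
    (hinj : ∀ c d, row c = row d → col c = col d → c = d) {T : C → Fin n}
    (hTi : Function.Injective T) (hT : IncreasingAlong row col T) :
    ∀ (m : ℕ) (ρ : Perm C), colMeasure B col (T ∘ ρ) = m → ρ ∈ labelGroup row → ρ ≠ 1 →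
      colMeasure B col T < colMeasure B col (T ∘ ρ) := by
  intro m
  induction m using Nat.strong_induction_on with
  | _ m ih =>
    intro ρ hm hρ hne
    have hTρ : ¬ IncreasingAlong row col (T ∘ ρ) := fun h =>
      hne (eq_one_of_increasingAlong hinj hT hρ h)
    obtain ⟨c, d, hr, hc, hlt⟩ := exists_inversion (hTi.comp ρ.injective) hTρ
    have hlt' := colMeasure_swap_lt hB hc hlt
    have hcomp : (T ∘ ρ) ∘ swap c d = T ∘ (ρ * swap c d : Perm C) := rfl
    rw [hcomp] at hlt'
    by_cases h1 : ρ * swap c d = 1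
    · rw [h1] at hlt'
      exact hlt'
    · exact (ih _ (hm ▸ hlt') _ rfl
        ((labelGroup row).mul_mem hρ (swap_mem_labelGroup hr)) h1).trans hlt'

/-! ### Row sums, Garnir relations and straightening -/

variable {W : Type*} [AddCommGroup W]

/-- The signed sum `∑ χ(ρ) [T ∘ ρ]` over the row preserving permutations `ρ` of the cells. -/
def rowSum (row : C → ℕ) (χ : Perm C →* ℤˣ) (br : (C → Fin n) → W) (T : C → Fin n) : W :=
  ∑ ρ : labelGroup row, χ (ρ : Perm C) • br (T ∘ (ρ : Perm C))

theorem rowSum_comp (row : C → ℕ) (χ : Perm C →* ℤˣ) (br : (C → Fin n) → W) (T : C → Fin n)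
    {σ : Perm C} (hσ : σ ∈ labelGroup row) :
    rowSum row χ br (T ∘ σ) = χ σ • rowSum row χ br T := by
  have hχ : χ σ * χ σ = 1 := by rw [← sq, Int.units_sq]
  unfold rowSum
  rw [← Equiv.sum_comp (Equiv.mulLeft (⟨σ, hσ⟩ : labelGroup row))
    (fun ρ : labelGroup row => χ (ρ : Perm C) • br (T ∘ (ρ : Perm C))), Finset.smul_sum]
  refine Finset.sum_congr rfl fun ρ _ => ?_
  rw [smul_smul, coe_mulLeft, Subgroup.coe_mul, map_mul, ← mul_assoc, hχ, one_mul]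
  rfl

/-- The Garnir relation. The set `P` of cells meets each rearrangement of the rows in two cells of
a common column, so the signed sum over all products of a permutation of `P` and a row preserving
permutation vanishes; this expresses the row sum of `T` by row sums of the fillings obtained by
permuting the entries in `P` so that some of them change their row. -/
theorem garnir {R : Type*} [Ring R] [Module R W] {row col : C → ℕ} {χ : Perm C →* ℤˣ}
    {br : (C → Fin n) → W}
    (hbr : ∀ (T : C → Fin n) c d, c ≠ d → col c = col d →
      br (T ∘ swap c d) = -(χ (swap c d) • br T))
    (T : C → Fin n) (P : Finset C)
    (hP : ∀ Z : Finset C, #P = #Z → (∀ z ∈ Z, ∃ p ∈ P, row z = row p) →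
      ∃ z ∈ Z, ∃ z' ∈ Z, z ≠ z' ∧ col z = col z')
    (U : Submodule R W)
    (hU : ∀ σ : Perm C, (∀ z ∉ P, σ z = z) → σ ∉ labelGroup row → rowSum row χ br (T ∘ σ) ∈ U) :
    rowSum row χ br T ∈ U := by
  classical
  let G : Finset (Perm C) := univ.filter fun g =>
    ∃ σ ρ : Perm C, (∀ z ∉ P, σ z = z) ∧ ρ ∈ labelGroup row ∧ g = σ * ρ
  let f : Perm C → W := fun g => χ g • br (T ∘ g)
  let Z : Perm C → Finset C := fun g => univ.filter fun z => g z ∈ P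
  have hmemZ : ∀ g z, z ∈ Z g ↔ g z ∈ P := fun g z => by simp [Z]
  have hZ : ∀ g, #P = #(Z g) := by
    intro g
    have : Z g = P.map (g⁻¹ : Perm C).toEmbedding := by
      ext z
      simp only [Z, mem_filter, mem_univ, true_and, mem_map, Equiv.coe_toEmbedding]
      exact ⟨fun h => ⟨g z, h, by simp⟩, by rintro ⟨p, hp, rfl⟩; simpa using hp⟩
    rw [this, card_map]
  have hstab : ∀ σ : Perm C, (∀ z ∉ P, σ z = z) → ∀ z, σ z ∈ P → z ∈ P := by
    intro σ hσ z hz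
    by_contra h
    rw [hσ z h] at hz
    exact h hz
  have hGZ : ∀ g ∈ G, ∃ z ∈ Z g, ∃ z' ∈ Z g, z ≠ z' ∧ col z = col z' := by
    intro g hg
    obtain ⟨σ, ρ, hσ, hρ, rfl⟩ := (mem_filter.1 hg).2
    refine hP _ (hZ _) fun z hz => ⟨ρ z, hstab σ hσ _ (mem_filter.1 hz).2, (hρ z).symm⟩
  -- The transposition of two cells of `Y` in a common column; it depends only on `Y`.
  have hpick : ∀ Y : Finset C, ∃ τ : Perm C, (∃ z ∈ Y, ∃ z' ∈ Y, z ≠ z' ∧ col z = col z') →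
      ∃ z ∈ Y, ∃ z' ∈ Y, z ≠ z' ∧ col z = col z' ∧ τ = swap z z' := by
    intro Y
    by_cases h : ∃ z ∈ Y, ∃ z' ∈ Y, z ≠ z' ∧ col z = col z'
    · obtain ⟨z, hz, z', hz', hne, hcol⟩ := h
      exact ⟨swap z z', fun _ => ⟨z, hz, z', hz', hne, hcol, rfl⟩⟩
    · exact ⟨1, fun h' => absurd h' h⟩
  choose pick hpick using hpick
  have hZpick : ∀ g ∈ G, Z (g * pick (Z g)) = Z g := by
    intro g hg
    obtain ⟨z, hz, z', hz', -, -, e⟩ := hpick _ (hGZ g hg)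
    rw [e]
    have hz1 : g z ∈ P := (mem_filter.1 hz).2
    have hz2 : g z' ∈ P := (mem_filter.1 hz').2
    ext x
    rw [hmemZ, hmemZ, Perm.mul_apply]
    by_cases hx : x = z
    · subst hx; simp [hz1, hz2]
    by_cases hx' : x = z'
    · subst hx'; simp [hz1, hz2]
    rw [swap_apply_of_ne_of_ne hx hx']
  have hpick2 : ∀ g ∈ G, pick (Z g) * pick (Z g) = 1 := by
    intro g hg
    obtain ⟨z, -, z', -, -, -, e⟩ := hpick _ (hGZ g hg)
    rw [e, swap_mul_self]
  have hsum : ∑ g ∈ G, f g = 0 := by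
    refine Finset.sum_involution (fun g _ => g * pick (Z g)) ?_ ?_ ?_ ?_
    · intro g hg
      obtain ⟨z, -, z', -, hne, hcol, e⟩ := hpick _ (hGZ g hg)
      have hχ : χ (swap z z') * χ (swap z z') = 1 := by rw [← sq, Int.units_sq]
      have : T ∘ (g * pick (Z g) : Perm C) = (T ∘ g) ∘ swap z z' := by rw [e]; rfl
      simp only [f]
      rw [this, hbr _ _ _ hne hcol, e, map_mul, smul_neg, smul_smul, mul_assoc, hχ, mul_one,
        add_neg_cancel]
    · intro g hg _ e
      obtain ⟨z, -, z', -, hne, -, e'⟩ := hpick _ (hGZ g hg)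
      rw [mul_eq_left, e'] at e
      exact hne (swap_eq_one_iff.1 e)
    · intro g hg
      obtain ⟨z, hz, z', hz', -, -, e⟩ := hpick _ (hGZ g hg)
      obtain ⟨σ, ρ, hσ, hρ, hg'⟩ := (mem_filter.1 hg).2
      refine mem_filter.2 ⟨mem_univ _, swap (g z) (g z') * σ, ρ, fun x hx => ?_, hρ, ?_⟩
      · have h1 : x ≠ g z := fun h => hx (h ▸ (mem_filter.1 hz).2)
        have h2 : x ≠ g z' := fun h => hx (h ▸ (mem_filter.1 hz').2)
        rw [Perm.mul_apply, hσ x hx, swap_apply_of_ne_of_ne h1 h2]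
      · rw [e, mul_assoc, ← hg', mul_swap_eq_swap_mul]
    · intro g hg
      rw [hZpick g hg, mul_assoc, hpick2 g hg, mul_one]
  -- The sum over `G` is the row sum of `T`, up to the terms that change a row.
  let G₁ := G.filter fun g => g ∈ labelGroup row
  let G₂ := G.filter fun g => g ∉ labelGroup row
  have h1 : ∑ g ∈ G₁, f g = rowSum row χ br T := by
    refine (Finset.sum_bij (fun (ρ : labelGroup row) _ => (ρ : Perm C)) ?_ ?_ ?_ ?_).symm
    · intro ρ _
      exact mem_filter.2 ⟨mem_filter.2 ⟨mem_univ _, 1, ρ, fun _ _ => rfl, ρ.2, by simp⟩, ρ.2⟩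
    · intro ρ _ ρ' _ e
      exact Subtype.ext e
    · intro g hg
      exact ⟨⟨g, (mem_filter.1 hg).2⟩, mem_univ _, rfl⟩
    · intro ρ _
      rfl
  have h2 : ∑ g ∈ G₂, f g ∈ U := by
    refine sum_mem_of_sum_coset_mem (labelGroup row) G₂ ?_ f U ?_
    · intro g hg h hh
      obtain ⟨hg, hg'⟩ := mem_filter.1 hg
      obtain ⟨σ, ρ, hσ, hρ, rfl⟩ := (mem_filter.1 hg).2
      refine mem_filter.2 ⟨mem_filter.2 ⟨mem_univ _, σ, ρ * h, hσ,
        (labelGroup row).mul_mem hρ hh, mul_assoc _ _ _⟩, fun h' => hg' ?_⟩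
      exact ((labelGroup row).mul_mem_cancel_right hh).1 h'
    · intro g hg
      obtain ⟨hg, hg'⟩ := mem_filter.1 hg
      obtain ⟨σ, ρ, hσ, hρ, rfl⟩ := (mem_filter.1 hg).2
      have : ∑ h : labelGroup row, f (σ * ρ * h) =
          χ (σ * ρ) • rowSum row χ br ((T ∘ σ) ∘ ρ) := by
        rw [rowSum, Finset.smul_sum]
        refine Finset.sum_congr rfl fun h _ => ?_
        simp only [f]
        rw [map_mul, mul_smul]
        rfl
      rw [this, rowSum_comp _ _ _ _ hρ, Units.smul_def, Units.smul_def]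
      refine U.toAddSubgroup.zsmul_mem (U.toAddSubgroup.zsmul_mem (hU σ hσ fun h => hg' ?_) _) _
      exact (labelGroup row).mul_mem h hρ
  have h3 : ∑ g ∈ G₁, f g + ∑ g ∈ G₂, f g = 0 := by
    rw [Finset.sum_filter_add_sum_filter_not, hsum]
  rw [← h1, eq_neg_of_add_eq_zero_left h3]
  exact U.neg_mem h2

/-- The straightening law: the row sum of a filling with distinct entries is a combination of the
row sums of standard fillings with the same entries. In a row with a descent two entries are
exchanged; at a descent in a column the Garnir relation moves larger entries to lower rows. -/
theorem rowSum_mem_span_standard {R : Type*} [Ring R] [Module R W] {row col : C → ℕ}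
    (hinj : ∀ c d, row c = row d → col c = col d → c = d) {χ : Perm C →* ℤˣ}
    {br : (C → Fin n) → W}
    (hbr : ∀ (T : C → Fin n) c d, c ≠ d → col c = col d →
      br (T ∘ swap c d) = -(χ (swap c d) • br T))
    (hP : ∀ c d, row c < row d → col c = col d → ∀ Z : Finset C,
      #(univ.filter fun x => row x = row c ∧ col c ≤ col x) +
        #(univ.filter fun x => row x = row d ∧ col x ≤ col d) = #Z →
      (∀ z ∈ Z, row z = row c ∨ row z = row d) →
      ∃ z ∈ Z, ∃ z' ∈ Z, z ≠ z' ∧ col z = col z')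
    (T : C → Fin n) (hT : Function.Injective T) :
    rowSum row χ br T ∈ Submodule.span R
      {x | ∃ S, IsStandard row col S ∧ (∃ σ : Perm C, S = T ∘ σ) ∧ x = rowSum row χ br S} := by
  set U := Submodule.span R
      {x | ∃ S, IsStandard row col S ∧ (∃ σ : Perm C, S = T ∘ σ) ∧ x = rowSum row χ br S} with hUdef
  set A := univ.sup row
  set B := univ.sup col
  have hA : ∀ c, row c ≤ A := fun c => Finset.le_sup (f := row) (mem_univ c)
  have hB : ∀ c, col c ≤ B := fun c => Finset.le_sup (f := col) (mem_univ c)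
  have key : ∀ (m : ℕ ×ₗ ℕ) (σ : Perm C),
      toLex (colMeasure A row (T ∘ σ), colMeasure B col (T ∘ σ)) = m →
        rowSum row χ br (T ∘ σ) ∈ U := by
    intro m
    induction m using WellFoundedLT.induction with
    | _ m ih =>
      intro σ hm
      have hTσ := hT.comp σ.injective
      by_cases hrow : IncreasingAlong row col (T ∘ σ)
      · by_cases hcol : IncreasingAlong col row (T ∘ σ)
        · exact Submodule.subset_span ⟨_, ⟨hrow, hcol, hTσ⟩, ⟨σ, rfl⟩, rfl⟩
        · obtain ⟨c, d, hc, hr, hlt⟩ := exists_inversion hTσ hcol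
          let X := univ.filter fun x => row x = row c ∧ col c ≤ col x
          let Y := univ.filter fun x => row x = row d ∧ col x ≤ col d
          have hX : ∀ x ∈ X, (T ∘ σ) c ≤ (T ∘ σ) x := by
            intro x hx
            obtain ⟨h1, h2⟩ := (mem_filter.1 hx).2
            rcases h2.eq_or_lt with h2 | h2
            · rw [hinj _ _ h1.symm h2]
            · exact (hrow _ _ h1.symm h2).le
          have hY : ∀ x ∈ Y, (T ∘ σ) x < (T ∘ σ) c := by
            intro x hx
            obtain ⟨h1, h2⟩ := (mem_filter.1 hx).2
            refine lt_of_le_of_lt ?_ hlt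
            rcases h2.eq_or_lt with h2 | h2
            · rw [hinj _ _ h1 h2]
            · exact (hrow _ _ h1 h2).le
          have hXY : Disjoint X Y := Finset.disjoint_left.2 fun x hx hy =>
            absurd (hX x hx) (not_le.2 (hY x hy))
          have hrX : ∀ x ∈ X, row x = row c := fun x hx => (mem_filter.1 hx).2.1
          have hrY : ∀ x ∈ Y, row x = row d := fun x hx => (mem_filter.1 hx).2.1
          refine garnir hbr (T ∘ σ) (X ∪ Y) ?_ U ?_
          · intro Z hZ hZ'
            rw [card_union_of_disjoint hXY] at hZ
            refine hP c d hr hc Z hZ fun z hz => ?_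
            obtain ⟨p, hp, e⟩ := hZ' z hz
            rcases mem_union.1 hp with hp | hp
            · exact Or.inl (e.trans (hrX p hp))
            · exact Or.inr (e.trans (hrY p hp))
          · intro τ hτ hτr
            have hτ' : ∀ z ∉ X ∪ Y, τ⁻¹ z = z := fun z hz => by
              rw [Perm.inv_eq_iff_eq, hτ z hz]
            have hτm : ∀ z ∈ X ∪ Y, τ⁻¹ z ∈ X ∪ Y := fun z hz => by
              by_contra h
              have := hτ _ h
              simp only [Perm.coe_inv, apply_symm_apply] at this
              rw [this] at hz
              exact h (by simpa using hz)
            have hcase : ∀ x, (row x = row (τ⁻¹ x)) ∨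
                (row x < row (τ⁻¹ x) ∧ (T ∘ σ) c ≤ (T ∘ σ) x) ∨
                (row (τ⁻¹ x) < row x ∧ (T ∘ σ) x < (T ∘ σ) c) := by
              intro x
              by_cases hx : x ∈ X ∪ Y
              · rcases mem_union.1 hx with h | h <;> rcases mem_union.1 (hτm x hx) with h' | h'
                · exact Or.inl ((hrX _ h).trans (hrX _ h').symm)
                · exact Or.inr (Or.inl ⟨by rw [hrX _ h, hrY _ h']; exact hr, hX _ h⟩)
                · exact Or.inr (Or.inr ⟨by rw [hrY _ h, hrX _ h']; exact hr, hY _ h⟩)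
                · exact Or.inl ((hrY _ h).trans (hrY _ h').symm)
              · exact Or.inl (by rw [hτ' x hx])
            refine ih _ ?_ (σ * τ) rfl
            rw [← hm, Prod.Lex.toLex_lt_toLex]
            refine Or.inl (colMeasure_comp_lt (T := T ∘ σ) ((T ∘ σ) c) hA hcase ?_)
            -- Otherwise no cell of `Y` receives an entry of `X`, and `τ` preserves the rows.
            by_contra hno
            push Not at hno
            have hle : ∀ x, row x ≤ row (τ⁻¹ x) := by
              intro x
              rcases hcase x with h | h | h
              · exact h.le
              · exact h.1.le
              · exact absurd (hno x h.1) (not_le.2 h.2)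
            have heq : ∀ x, row x = row (τ⁻¹ x) := by
              have hs : ∑ x, row (τ⁻¹ x) = ∑ x, row x := Equiv.sum_comp τ⁻¹ row
              intro x
              exact (Finset.sum_eq_sum_iff_of_le fun x _ => hle x).1 hs.symm x (mem_univ x)
            exact hτr fun x => by simpa using heq (τ x)
      · obtain ⟨c, d, hr, hc, hlt⟩ := exists_inversion hTσ hrow
        have hs := swap_mem_labelGroup (row := row) hr
        have hmem := ih _ (by
          rw [← hm, Prod.Lex.toLex_lt_toLex]
          exact Or.inr ⟨colMeasure_comp_of_mem A (T ∘ σ) hs, colMeasure_swap_lt hB hc hlt⟩)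
          (σ * swap c d) rfl
        have hcomp : rowSum row χ br (T ∘ (σ * swap c d : Perm C)) =
            χ (swap c d) • rowSum row χ br (T ∘ σ) := rowSum_comp row χ br (T ∘ σ) hs
        have hχ : χ (swap c d) * χ (swap c d) = 1 := by rw [← sq, Int.units_sq]
        have := U.toAddSubgroup.zsmul_mem hmem (χ (swap c d) : ℤˣ)
        rw [hcomp, ← Units.smul_def, smul_smul, hχ, one_smul] at this
        exact this
  exact key _ 1 rfl

/-- If a functional vanishes on all `br w` except those for which `w` arises from `T` by permuting
the columns, then on the row sum of a standard filling `S` it is nonzero only if `S = T` or `S` has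
smaller measure than `T`. -/
theorem eq_or_colMeasure_lt {R : Type*} [Ring R] [Module R W] {row col : C → ℕ}
    (hinj : ∀ c d, row c = row d → col c = col d → c = d) {χ : Perm C →* ℤˣ}
    {br : (C → Fin n) → W} {T S : C → Fin n} (Φ : W →ₗ[R] R)
    (hΦ : ∀ w, Φ (br w) ≠ 0 → ∃ τ ∈ labelGroup col, w = T ∘ τ)
    (hT : IsStandard row col T) (hS : IsStandard row col S) {B : ℕ} (hB : ∀ c, col c ≤ B)
    (h : Φ (rowSum row χ br S) ≠ 0) : S = T ∨ colMeasure B col S < colMeasure B col T := by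
  rw [rowSum, map_sum] at h
  obtain ⟨ρ, -, hρ⟩ := Finset.exists_ne_zero_of_sum_ne_zero h
  rw [Units.smul_def, map_zsmul] at hρ
  obtain ⟨τ, hτ, e⟩ := hΦ _ (right_ne_zero_of_smul hρ)
  by_cases h1 : (ρ : Perm C) = 1
  · left
    rw [h1, Perm.coe_one, Function.comp_id] at e
    have : τ = 1 := eq_one_of_increasingAlong (fun c d h1 h2 => hinj c d h2 h1) hT.2.1 hτ
      (e ▸ hS.2.1)
    rw [e, this, Perm.coe_one, Function.comp_id]
  · right
    have := colMeasure_lt_comp hB hinj hS.2.2 hS.1 _ _ rfl ρ.2 h1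
    rwa [e, colMeasure_comp_of_mem B T hτ] at this

theorem apply_rowSum_self {R : Type*} [Ring R] [Module R W] {row col : C → ℕ}
    (hinj : ∀ c d, row c = row d → col c = col d → c = d) {χ : Perm C →* ℤˣ}
    {br : (C → Fin n) → W} {T : C → Fin n} (hT : Function.Injective T) (Φ : W →ₗ[R] R)
    (hΦ : ∀ w, Φ (br w) ≠ 0 → ∃ τ ∈ labelGroup col, w = T ∘ τ) :
    Φ (rowSum row χ br T) = Φ (br T) := by
  rw [rowSum, map_sum, Finset.sum_eq_single 1]
  · simp
  · intro ρ _ hne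
    by_contra hρ
    rw [Units.smul_def, map_zsmul] at hρ
    obtain ⟨τ, hτ, e⟩ := hΦ _ (right_ne_zero_of_smul hρ)
    refine hne (Subtype.ext (Equiv.ext fun c => hinj _ _ (ρ.2 c) ?_))
    have : (ρ : Perm C) c = τ c := hT (congrFun e c)
    rw [this]
    exact hτ c
  · intro h
    exact absurd (mem_univ _) h

end Combinatorics

/-! ### Weight spaces of a representation spanned by weight vectors -/

section WeightVectors

open Finset

variable {𝕜 : Type*} [Field 𝕜] {n : ℕ}

variable (𝕜) in
/-- The character `t ↦ t_1^{α_1} ⋯ t_n^{α_n}` of the group of invertible diagonal matrices. -/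
def weightChar (α : Fin n → ℕ) : (Fin n → 𝕜ˣ) →* 𝕜 where
  toFun t := ∏ i, (t i : 𝕜) ^ α i
  map_one' := by simp
  map_mul' s t := by simp [mul_pow, Finset.prod_mul_distrib]

theorem weightChar_apply (α : Fin n → ℕ) (t : Fin n → 𝕜ˣ) :
    weightChar 𝕜 α t = ∏ i, (t i : 𝕜) ^ α i := rfl

theorem weightChar_injective [Infinite 𝕜] :
    Function.Injective (weightChar 𝕜 : (Fin n → ℕ) → (Fin n → 𝕜ˣ) →* 𝕜) := by
  intro α β h
  funext i
  by_contra hne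
  have hpow : ∀ s : 𝕜, s ≠ 0 → s ^ α i = s ^ β i := by
    intro s hs
    have := DFunLike.congr_fun h (Function.update (1 : Fin n → 𝕜ˣ) i (Units.mk0 s hs))
    rw [weightChar_apply, weightChar_apply, Finset.prod_eq_single i,
      Finset.prod_eq_single i] at this
    · simpa using this
    all_goals simp +contextual [Function.update_of_ne]
  have hpoly : (Polynomial.X ^ α i - Polynomial.X ^ β i : Polynomial 𝕜) * Polynomial.X = 0 := by
    refine Polynomial.funext fun s => ?_
    by_cases hs : s = 0
    · simp [hs]
    · simp [hpow s hs]
  rcases mul_eq_zero.1 hpoly with h0 | h0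
  · have := congrArg (fun p => Polynomial.coeff p (α i)) (sub_eq_zero.1 h0)
    simp [Polynomial.coeff_X_pow, hne] at this
  · exact Polynomial.X_ne_zero h0

variable {C : Type*} [Fintype C]

/-- The content of a filling: how often each entry occurs. -/
def content (T : C → Fin n) (i : Fin n) : ℕ := #(univ.filter fun c => T c = i)

theorem prod_comp_eq_weightChar (T : C → Fin n) (t : Fin n → 𝕜ˣ) :
    ∏ c, (t (T c) : 𝕜) = weightChar 𝕜 (content T) t := by
  rw [weightChar_apply, ← Finset.prod_fiberwise univ T]
  refine Finset.prod_congr rfl fun i _ => ?_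
  rw [content, Finset.prod_congr rfl fun c hc => by rw [(mem_filter.1 hc).2], Finset.prod_const]

theorem sum_content (T : C → Fin n) : ∑ i, content T i = Fintype.card C := by
  simp only [content]
  rw [← Finset.card_eq_sum_card_fiberwise (fun _ _ => mem_univ _), Finset.card_univ]

theorem content_comp (T : C → Fin n) (σ : Equiv.Perm C) : content (T ∘ σ) = content T := by
  funext i
  exact Finset.card_equiv σ (by simp)

theorem injective_iff_content_le_one (T : C → Fin n) :
    Function.Injective T ↔ ∀ i, content T i ≤ 1 := by
  simp only [content, Finset.card_le_one, mem_filter, mem_univ, true_and]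
  exact ⟨fun h i c hc d hd => h (hc.trans hd.symm), fun h c d e => h _ c e d rfl⟩

theorem content_eq_of_lt {r : ℕ} (hr : Fintype.card C = r) {T : C → Fin n}
    (hT : Function.Injective T) :
    (content T = fun i : Fin n => if (i : ℕ) < r then 1 else 0) ↔ ∀ c, (T c : ℕ) < r := by
  constructor
  · intro h c
    have := congrFun h (T c)
    by_contra hlt
    rw [if_neg hlt, content, Finset.card_eq_zero, Finset.filter_eq_empty_iff] at this
    exact this (mem_univ c) rfl
  · intro h
    have hle : ∀ i, content T i ≤ if (i : ℕ) < r then 1 else 0 := by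
      intro i
      split_ifs with hi
      · exact (injective_iff_content_le_one T).1 hT i
      · rw [content, Nat.le_zero, Finset.card_eq_zero, Finset.filter_eq_empty_iff]
        intro c _ e
        exact hi (e ▸ h c)
    have hcard : ∑ i : Fin n, (if (i : ℕ) < r then 1 else 0) ≤ r := by
      rw [← Finset.card_filter]
      calc #(univ.filter fun i : Fin n => (i : ℕ) < r)
          ≤ #(Finset.range r) := Finset.card_le_card_of_injOn (fun i => (i : ℕ))
            (fun i hi => by simpa using hi) (Fin.val_injective.injOn)
        _ = r := Finset.card_range r
    funext i
    refine (Finset.sum_eq_sum_iff_of_le fun i _ => hle i).1 (le_antisymm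
      (Finset.sum_le_sum fun i _ => hle i) ?_) i (mem_univ i)
    rw [sum_content, hr]
    exact hcard

variable {M : Type*} [AddCommGroup M] [Module 𝕜 M]
  {ρ : Representation 𝕜 (Matrix (Fin n) (Fin n) 𝕜) M} {x : (C → Fin n) → M}

/-- If weight vectors `x T` span the representation, then each weight space is spanned by those of
them that have its weight, since distinct characters are linearly independent. -/
theorem weightSpace_le_span [Infinite 𝕜] (hspan : ⊤ ≤ Submodule.span 𝕜 (Set.range x))
    (hx : ∀ T, x T ∈ weightSpace ρ (content T)) (α : Fin n → ℕ) :
    weightSpace ρ α ≤ Submodule.span 𝕜 (x '' {T | content T = α}) := by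
  classical
  intro y hy
  obtain ⟨g, hg⟩ := (Submodule.mem_span_range_iff_exists_fun 𝕜).1
    (hspan (Submodule.mem_top : y ∈ ⊤))
  have hLI : LinearIndependent 𝕜 fun β : Fin n → ℕ => (weightChar 𝕜 β : (Fin n → 𝕜ˣ) → 𝕜) :=
    (linearIndependent_monoidHom (Fin n → 𝕜ˣ) 𝕜).comp _ weightChar_injective
  rw [linearIndependent_iff'] at hLI
  suffices h : y = ∑ T with content T = α, g T • x T by
    rw [h]
    exact Submodule.sum_mem _ fun T hT => Submodule.smul_mem _ _
      (Submodule.subset_span ⟨T, (mem_filter.1 hT).2, rfl⟩)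
  rw [← sub_eq_zero, ← forall_dual_apply_eq_zero_iff 𝕜]
  intro φ
  have hφ : ∀ t, ∑ T, g T * φ (x T) * weightChar 𝕜 (content T) t = φ y * weightChar 𝕜 α t := by
    intro t
    have h1 : ρ (Matrix.diagonal fun i => (t i : 𝕜)) y = weightChar 𝕜 α t • y := hy t
    rw [← hg, map_sum] at h1
    have h2 := congrArg φ h1
    rw [map_sum, hg, map_smul, smul_eq_mul, mul_comm] at h2
    rw [← h2]
    refine Finset.sum_congr rfl fun T _ => ?_
    have h3 : ρ (Matrix.diagonal fun i => (t i : 𝕜)) (x T) =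
      weightChar 𝕜 (content T) t • x T := hx T t
    rw [map_smul, h3, map_smul, map_smul, smul_eq_mul, smul_eq_mul]
    ring
  have h := hLI (insert α (univ.image content))
    (fun β => ∑ T with content T = β, g T * φ (x T) - if β = α then φ y else 0) (by
      funext t
      rw [Finset.sum_apply]
      simp only [Pi.smul_apply, smul_eq_mul, sub_mul, Finset.sum_sub_distrib, Pi.zero_apply,
        ite_mul, zero_mul, Finset.sum_ite_eq', mem_insert_self, if_true]
      rw [← hφ t, sub_eq_zero, ← Finset.sum_fiberwise_of_maps_to
        (t := insert α (univ.image content)) (g := content)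
        (fun T _ => mem_insert_of_mem (mem_image_of_mem _ (mem_univ _)))]
      refine Finset.sum_congr rfl fun β _ => ?_
      rw [Finset.sum_mul]
      exact Finset.sum_congr rfl fun T hT => by rw [(mem_filter.1 hT).2]) α (mem_insert_self _ _)
  rw [if_pos rfl, sub_eq_zero] at h
  rw [map_sub, map_sum, ← h]
  simp

theorem nonSquareFree_le_span [Infinite 𝕜] (hspan : ⊤ ≤ Submodule.span 𝕜 (Set.range x))
    (hx : ∀ T, x T ∈ weightSpace ρ (content T)) (r : ℕ) :
    nonSquareFree ρ r ≤ Submodule.span 𝕜 (x '' {T | ¬ Function.Injective T}) := by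
  refine iSup₂_le fun α hα => (weightSpace_le_span hspan hx α).trans (Submodule.span_mono ?_)
  refine Set.image_mono fun T hT => ?_
  obtain ⟨-, j, hj⟩ := hα
  rw [Set.mem_ofPred_eq, injective_iff_content_le_one]
  intro h
  have := h j
  rw [show content T = α from hT] at this
  omega

theorem mem_nonSquareFree (hx : ∀ T, x T ∈ weightSpace ρ (content T)) {T : C → Fin n}
    (hT : ¬ Function.Injective T) : x T ∈ nonSquareFree ρ (Fintype.card C) := by
  rw [injective_iff_content_le_one] at hT
  push Not at hT
  exact Submodule.mem_iSup_of_mem (content T)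
    (Submodule.mem_iSup_of_mem ⟨sum_content T, hT⟩ (hx T))

/-- Vectors on which a family of functionals is triangular are linearly independent. -/
theorem linearIndependent_of_triangular {ι E : Type*} [AddCommGroup E] [Module 𝕜 E] {v : ι → E}
    (Φ : ι → E →ₗ[𝕜] 𝕜) (m : ι → ℕ) (h1 : ∀ T, Φ T (v T) = 1)
    (h2 : ∀ T S, Φ T (v S) ≠ 0 → S = T ∨ m S < m T) : LinearIndependent 𝕜 v := by
  classical
  rw [linearIndependent_iff']
  intro s g hg
  by_contra! hne
  obtain ⟨T, hT, hmin⟩ := Finset.exists_min_image (s.filter fun T => g T ≠ 0) m (by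
    obtain ⟨T, hT, hgT⟩ := hne
    exact ⟨T, mem_filter.2 ⟨hT, hgT⟩⟩)
  obtain ⟨hTs, hgT⟩ := mem_filter.1 hT
  refine hgT ?_
  have h := congrArg (Φ T) hg
  rw [map_sum, map_zero, Finset.sum_eq_single T] at h
  · simpa [h1] using h
  · intro S hS hST
    rw [map_smul, smul_eq_mul]
    by_contra h0
    rcases h2 T S (right_ne_zero_of_mul h0) with e | hlt
    · exact hST e
    · exact absurd (hmin S (mem_filter.2 ⟨hS, left_ne_zero_of_mul h0⟩)) (not_le.2 hlt)
  · exact fun h => absurd hTs h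

/-- A representation spanned by weight vectors `x T`, one for each filling `T` of a set of cells,
such that those with `T` injective are combinations of those with `T` distinguished, and that a
family of functionals is triangular on the latter. -/
structure StandardSystem (ρ : Representation 𝕜 (Matrix (Fin n) (Fin n) 𝕜) M)
    (x : (C → Fin n) → M) (P : (C → Fin n) → Prop) : Prop where
  span : ⊤ ≤ Submodule.span 𝕜 (Set.range x)
  weight : ∀ T, x T ∈ weightSpace ρ (content T)
  injective : ∀ T, P T → Function.Injective T
  straighten : ∀ T, Function.Injective T →
    x T ∈ Submodule.span 𝕜 {y | ∃ S, P S ∧ (∃ σ : Equiv.Perm C, S = T ∘ σ) ∧ y = x S}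
  triangular : ∃ (Φ : (C → Fin n) → M →ₗ[𝕜] 𝕜) (m : (C → Fin n) → ℕ),
    (∀ T, P T → Φ T (x T) = 1) ∧
    (∀ T S, P T → P S → Φ T (x S) ≠ 0 → S = T ∨ m S < m T) ∧
    (∀ T S, P T → Φ T (x S) ≠ 0 → Function.Injective S)

namespace StandardSystem

variable {P : (C → Fin n) → Prop}

theorem linearIndependent_mkQ [Infinite 𝕜] (h : StandardSystem ρ x P) (r : ℕ) :
    LinearIndependent 𝕜 fun T : {T // P T} => (nonSquareFree ρ r).mkQ (x T) := by
  obtain ⟨Φ, m, h1, h2, h3⟩ := h.triangular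
  have hker : ∀ T : {T // P T}, nonSquareFree ρ r ≤ LinearMap.ker (Φ T) := by
    intro T
    refine (nonSquareFree_le_span h.span h.weight r).trans (Submodule.span_le.2 ?_)
    rintro _ ⟨S, hS, rfl⟩
    by_contra h0
    exact hS (h3 T S T.2 h0)
  refine linearIndependent_of_triangular
    (fun T => (nonSquareFree ρ r).liftQ (Φ T) (hker T)) (fun T => m T) ?_ ?_
  · intro T
    simpa using h1 T T.2
  · intro T S hTS
    rw [Submodule.mkQ_apply, Submodule.liftQ_apply] at hTS
    rcases h2 T S T.2 S.2 hTS with e | hlt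
    · exact Or.inl (Subtype.ext e)
    · exact Or.inr hlt

theorem span_mkQ (h : StandardSystem ρ x P) {r : ℕ} (hr : Fintype.card C = r) :
    ⊤ ≤ Submodule.span 𝕜 (Set.range fun T : {T // P T} => (nonSquareFree ρ r).mkQ (x T)) := by
  subst hr
  have hrange : Set.range (fun T : {T // P T} => (nonSquareFree ρ (Fintype.card C)).mkQ (x T)) =
      (nonSquareFree ρ (Fintype.card C)).mkQ '' Set.range (fun T : {T // P T} => x T) := by
    rw [← Set.range_comp]
    rfl
  rw [hrange, Submodule.span_image]
  rw [← Submodule.range_mkQ (nonSquareFree ρ (Fintype.card C)), LinearMap.range_eq_map,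
    ← Submodule.comap_le_comap_iff_of_surjective (Submodule.mkQ_surjective _),
    Submodule.comap_map_mkQ, Submodule.comap_map_mkQ]
  refine sup_le le_sup_left (h.span.trans (Submodule.span_le.2 ?_))
  rintro _ ⟨T, rfl⟩
  by_cases hT : Function.Injective T
  · refine (Submodule.span_mono ?_ |>.trans le_sup_right) (h.straighten T hT)
    rintro _ ⟨S, hS, -, rfl⟩
    exact ⟨⟨S, hS⟩, rfl⟩
  · exact Submodule.mem_sup_left (mem_nonSquareFree h.weight hT)

/-- The classes of the distinguished vectors form a basis of the quotient by the weight spaces of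
the weights that are not square free. -/
def basis [Infinite 𝕜] (h : StandardSystem ρ x P) {r : ℕ} (hr : Fintype.card C = r) :
    Basis {T // P T} 𝕜 (SymmetrizedSchur ρ r) :=
  Basis.mk (h.linearIndependent_mkQ r) (h.span_mkQ hr)

theorem basis_apply [Infinite 𝕜] (h : StandardSystem ρ x P) {r : ℕ} (hr : Fintype.card C = r)
    (T : {T // P T}) : h.basis hr T = (nonSquareFree ρ r).mkQ (x T) := by
  rw [basis, Basis.mk_apply]

/-- The weight space of `(1^r, 0, …)` has the distinguished vectors with entries `< r` as a basis:
they span it by straightening, which preserves the content, and they are independent because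
their classes modulo the weights that are not square free are. -/
theorem finrank_schurFunctor [Infinite 𝕜] (h : StandardSystem ρ x P) {r : ℕ}
    (hr : Fintype.card C = r) :
    finrank 𝕜 (schurFunctor ρ r) = Nat.card {T : {T // P T} // ∀ c, (T.1 c : ℕ) < r} := by
  classical
  have hLI : LinearIndependent 𝕜 fun T : {T : {T // P T} // ∀ c, (T.1 c : ℕ) < r} => x T.1 :=
    (LinearIndependent.of_comp (nonSquareFree ρ r).mkQ (h.linearIndependent_mkQ r)).comp _
      Subtype.val_injective
  have : Fintype {T : {T // P T} // ∀ c, (T.1 c : ℕ) < r} := Fintype.ofFinite _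
  have heq : schurFunctor ρ r =
      Submodule.span 𝕜 (Set.range fun T : {T : {T // P T} // ∀ c, (T.1 c : ℕ) < r} => x T.1) := by
    apply le_antisymm
    · refine (weightSpace_le_span h.span h.weight _).trans (Submodule.span_le.2 ?_)
      rintro _ ⟨T, hT, rfl⟩
      have hinj : Function.Injective T := by
        rw [injective_iff_content_le_one]
        intro i
        rw [show content T = _ from hT]
        dsimp only
        split_ifs <;> simp
      refine Submodule.span_mono ?_ (h.straighten T hinj)
      rintro _ ⟨S, hS, ⟨σ, rfl⟩, rfl⟩
      exact ⟨⟨⟨_, hS⟩, (content_eq_of_lt hr (h.injective _ hS)).1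
        ((content_comp T σ).trans hT)⟩, rfl⟩
    · refine Submodule.span_le.2 ?_
      rintro _ ⟨T, rfl⟩
      have := h.weight T.1.1
      rwa [(content_eq_of_lt hr (h.injective _ T.1.2)).2 T.2] at this
  rw [heq, finrank_span_eq_card hLI, Nat.card_eq_fintype_card]

end StandardSystem

end WeightVectors

/-! ### Products of vectors placed in the columns -/

section Bracket

open Equiv

variable {𝕜 : Type*} [Field 𝕜] {V : Type*} [AddCommGroup V] [Module 𝕜 V]
variable {B : Type*} [Ring B] [Algebra 𝕜 B] {ι : V →ₗ[𝕜] B} {ε : 𝕜}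
variable {C : Type*}

theorem exists_mul_prod_eq_smul (hι : ∀ u v, ι u * ι v = ε • (ι v * ι u)) (f : C → V)
    (L : List C) :
    ∃ s : 𝕜, ∀ v,
      ι v * (L.map fun x => ι (f x)).prod = s • ((L.map fun x => ι (f x)).prod * ι v) := by
  induction L with
  | nil => exact ⟨1, fun v => by simp⟩
  | cons x L ih =>
    obtain ⟨s, hs⟩ := ih
    refine ⟨ε * s, fun v => ?_⟩
    rw [List.map_cons, List.prod_cons, ← mul_assoc, hι v (f x), smul_mul_assoc, mul_assoc, hs v,
      mul_smul_comm, smul_smul, mul_assoc]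

theorem prod_map_swap_aux [DecidableEq C] (hι : ∀ u v, ι u * ι v = ε • (ι v * ι u)) (f : C → V)
    {L₁ L₂ L₃ : List C} {c d : C} (hL : (L₁ ++ c :: (L₂ ++ d :: L₃)).Nodup) :
    ((L₁ ++ c :: (L₂ ++ d :: L₃)).map fun x => ι (f (swap c d x))).prod =
      ε • ((L₁ ++ c :: (L₂ ++ d :: L₃)).map fun x => ι (f x)).prod := by
  have hmap : ∀ L : List C, c ∉ L → d ∉ L →
      (L.map fun x => ι (f (swap c d x))) = L.map fun x => ι (f x) := by
    intro L hc hd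
    refine List.map_congr_left fun x hx => ?_
    rw [swap_apply_of_ne_of_ne (ne_of_mem_of_not_mem hx hc) (ne_of_mem_of_not_mem hx hd)]
  simp only [List.nodup_append, List.nodup_cons, List.mem_append, List.mem_cons, not_or] at hL
  obtain ⟨-, ⟨⟨hc2, -, hc3⟩, -, ⟨hd3, -⟩, h2⟩, h1⟩ := hL
  have hc1 : c ∉ L₁ := fun h => h1 c h c (Or.inl rfl) rfl
  have hd1 : d ∉ L₁ := fun h => h1 d h d (Or.inr (Or.inr (Or.inl rfl))) rfl
  have hd2 : d ∉ L₂ := fun h => h2 d h d (Or.inl rfl) rfl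
  obtain ⟨s, hs⟩ := exists_mul_prod_eq_smul hι f L₂
  simp only [List.map_append, List.map_cons, List.prod_append, List.prod_cons, swap_apply_left,
    swap_apply_right, hmap _ hc1 hd1, hmap _ hc2 hd2, hmap _ hc3 hd3]
  have key : ι (f d) * ((L₂.map fun x => ι (f x)).prod * ι (f c)) =
      ε • (ι (f c) * ((L₂.map fun x => ι (f x)).prod * ι (f d))) := by
    rw [← mul_assoc, hs, smul_mul_assoc, mul_assoc, hι (f d) (f c), mul_smul_comm, ← mul_assoc,
      ← mul_assoc, hs, smul_mul_assoc, smul_comm, mul_assoc]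
  have key' := congrArg (fun y => (L₁.map fun x => ι (f x)).prod *
    (y * (L₃.map fun x => ι (f x)).prod)) key
  simpa only [mul_assoc, smul_mul_assoc, mul_smul_comm] using key'

/-- If vectors commute up to the factor `ε`, then exchanging two factors of a product of vectors
multiplies it by `ε`: the factors in between contribute the same scalar twice, once on each side. -/
theorem prod_map_swap [DecidableEq C] (hι : ∀ u v, ι u * ι v = ε • (ι v * ι u)) (f : C → V)
    {L : List C} (hL : L.Nodup) {c d : C} (hc : c ∈ L) (hd : d ∈ L) (hcd : c ≠ d) :
    (L.map fun x => ι (f (swap c d x))).prod = ε • (L.map fun x => ι (f x)).prod := by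
  obtain ⟨L₁, L₂, rfl⟩ := List.append_of_mem hc
  rcases List.mem_append.1 hd with hd | hd
  · obtain ⟨L₃, L₄, rfl⟩ := List.append_of_mem hd
    rw [swap_comm]
    simp only [List.append_assoc, List.cons_append] at hL ⊢
    exact prod_map_swap_aux hι f hL
  · obtain ⟨L₃, L₄, rfl⟩ := List.append_of_mem ((List.mem_cons.1 hd).resolve_left hcd.symm)
    exact prod_map_swap_aux hι f hL

variable {n k : ℕ}

variable (ι) in
/-- The product in `B ⊗ ⋯ ⊗ B`, over the cells `x` in the list `l`, of the vectors `e_{w(x)}`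
placed in the factor with the number `col x`. -/
def bracket (e : Fin n → V) (col : C → Fin k) (l : List C) (w : C → Fin n) :
    ⨂[𝕜] (_ : Fin k), B :=
  (l.map fun x => PiTensorProduct.singleAlgHom (R := 𝕜) (A := fun _ : Fin k => B) (col x)
    (ι (e (w x)))).prod

theorem bracket_eq_tprod (e : Fin n → V) (col : C → Fin k) (l : List C) (w : C → Fin n) :
    bracket ι e col l w = PiTensorProduct.tprod 𝕜 fun j =>
      ((l.filter fun x => col x = j).map fun x => ι (e (w x))).prod := by
  induction l with
  | nil => simp [bracket, PiTensorProduct.one_def]; rfl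
  | cons x l ih =>
    rw [bracket, List.map_cons, List.prod_cons]
    rw [bracket] at ih
    rw [ih, PiTensorProduct.singleAlgHom_apply, PiTensorProduct.tprod_mul_tprod]
    congr 1
    funext j
    by_cases hj : col x = j
    · subst hj
      simp
    · have hj' : j ≠ col x := fun h => hj h.symm
      simp [hj, hj']

theorem bracket_swap [DecidableEq C] (hι : ∀ u v, ι u * ι v = ε • (ι v * ι u)) (e : Fin n → V)
    {col : C → Fin k} {l : List C} (hl : l.Nodup) (w : C → Fin n) {c d : C} (hc : c ∈ l)
    (hd : d ∈ l) (hcd : c ≠ d) (hcol : col c = col d) :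
    bracket ι e col l (w ∘ swap c d) = ε • bracket ι e col l w := by
  rw [bracket_eq_tprod, bracket_eq_tprod]
  set F : Fin k → B := fun j => ((l.filter fun x => col x = j).map fun x => ι (e (w x))).prod
    with hF
  have hF' : (fun j => ((l.filter fun x => col x = j).map
      fun x => ι (e ((w ∘ swap c d) x))).prod) = Function.update F (col c) (ε • F (col c)) := by
    funext j
    by_cases hj : j = col c
    · subst hj
      rw [Function.update_self]
      exact prod_map_swap hι (fun x => e (w x)) (hl.filter _) (List.mem_filter.2 ⟨hc, by simp⟩)
        (List.mem_filter.2 ⟨hd, by simp [hcol]⟩) hcd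
    · rw [Function.update_of_ne hj, hF]
      dsimp only
      congr 1
      refine List.map_congr_left fun x hx => ?_
      have hx' : col x = j := by simpa using (List.mem_filter.1 hx).2
      rw [Function.comp_apply, swap_apply_of_ne_of_ne]
      · rintro rfl
        exact hj hx'.symm
      · rintro rfl
        exact hj (hx'.symm.trans hcol.symm)
  rw [hF', MultilinearMap.map_update_smul, Function.update_eq_self]

/-- The word formed by the entries of a column. -/
def colWord (col : C → Fin k) (l : List C) (w : C → Fin n) (j : Fin k) : List (Fin n) :=
  (l.filter fun x => col x = j).map w

/-- The tensor product over the columns of functionals `Ψ u` on `B`, where `u` is the word of the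
column of the filling `T`. -/
def colFunctional (Ψ : List (Fin n) → B →ₗ[𝕜] 𝕜) (col : C → Fin k) (l : List C) (T : C → Fin n) :
    (⨂[𝕜] (_ : Fin k), B) →ₗ[𝕜] 𝕜 :=
  PiTensorProduct.lift
    ((MultilinearMap.mkPiAlgebra 𝕜 (Fin k) 𝕜).compLinearMap fun j => Ψ (colWord col l T j))

theorem colFunctional_bracket (Ψ : List (Fin n) → B →ₗ[𝕜] 𝕜) (e : Fin n → V) (col : C → Fin k)
    (l : List C) (T w : C → Fin n) :
    colFunctional Ψ col l T (bracket ι e col l w) =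
      ∏ j, Ψ (colWord col l T j) ((colWord col l w j).map fun i => ι (e i)).prod := by
  rw [bracket_eq_tprod, colFunctional, PiTensorProduct.lift.tprod]
  simp [colWord, Function.comp_def]

theorem nodup_colWord (col : C → Fin k) {l : List C} (hl : l.Nodup) {T : C → Fin n}
    (hT : Function.Injective T) (j : Fin k) : (colWord col l T j).Nodup :=
  (hl.filter _).map hT

theorem colFunctional_bracket_self {Ψ : List (Fin n) → B →ₗ[𝕜] 𝕜} {e : Fin n → V}
    (hΨ : ∀ u : List (Fin n), u.Nodup → Ψ u (u.map fun i => ι (e i)).prod = 1) (col : C → Fin k)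
    {l : List C} (hl : l.Nodup) {T : C → Fin n} (hT : Function.Injective T) :
    colFunctional Ψ col l T (bracket ι e col l T) = 1 := by
  rw [colFunctional_bracket]
  exact Finset.prod_eq_one fun j _ => hΨ _ (nodup_colWord col hl hT j)

/-- If each `Ψ u` detects the words that are rearrangements of `u`, then the tensor product of
these functionals detects the fillings that arise by permuting the columns of `T`. -/
theorem exists_comp_of_colFunctional_ne_zero [Finite C] {Ψ : List (Fin n) → B →ₗ[𝕜] 𝕜}
    {e : Fin n → V} (hΨ : ∀ u L : List (Fin n), u.Nodup →
      Ψ u (L.map fun i => ι (e i)).prod ≠ 0 → L.Perm u) (col : C → Fin k)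
    {l : List C} (hl : l.Nodup) (hmem : ∀ x, x ∈ l) {T w : C → Fin n} (hT : Function.Injective T)
    (h : colFunctional Ψ col l T (bracket ι e col l w) ≠ 0) :
    ∃ τ ∈ labelGroup fun x => (col x : ℕ), w = T ∘ τ := by
  rw [colFunctional_bracket, Finset.prod_ne_zero_iff] at h
  have hperm : ∀ j, (colWord col l w j).Perm (colWord col l T j) := fun j =>
    hΨ _ _ (nodup_colWord col hl hT j) (h j (Finset.mem_univ j))
  have hex : ∀ x, ∃ y, col y = col x ∧ T y = w x := by
    intro x
    have : w x ∈ colWord col l w (col x) :=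
      List.mem_map.2 ⟨x, List.mem_filter.2 ⟨hmem x, by simp⟩, rfl⟩
    obtain ⟨y, hy, e⟩ := List.mem_map.1 ((hperm _).mem_iff.1 this)
    exact ⟨y, by simpa using (List.mem_filter.1 hy).2, e⟩
  choose τ hτ hτ' using hex
  have hinj : Function.Injective τ := by
    intro x y hxy
    have hcol : col x = col y := by rw [← hτ x, ← hτ y, hxy]
    have hw : w x = w y := by rw [← hτ' x, ← hτ' y, hxy]
    have hnd : (colWord col l w (col x)).Nodup :=
      (hperm _).nodup_iff.2 (nodup_colWord col hl hT _)
    exact List.inj_on_of_nodup_map hnd (List.mem_filter.2 ⟨hmem x, by simp⟩)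
      (List.mem_filter.2 ⟨hmem y, by simp [hcol]⟩) hw
  refine ⟨Equiv.ofBijective τ (Finite.injective_iff_bijective.1 hinj), fun x => ?_, ?_⟩
  · simp [hτ]
  · funext x
    simp [hτ']

end Bracket

/-! ### Functionals on the symmetric and the exterior algebra -/

section Functionals

variable {𝕜 : Type*} [Field 𝕜] {V : Type*} [AddCommGroup V] [Module 𝕜 V] {n : ℕ}
  (b : Basis (Fin n) 𝕜 V)

theorem equivMvPolynomial_prod_map (L : List (Fin n)) :
    SymmetricAlgebra.equivMvPolynomial b (L.map fun i => SymmetricAlgebra.ι 𝕜 V (b i)).prod =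
      MvPolynomial.monomial (Multiset.toFinsupp (L : Multiset (Fin n))) 1 := by
  induction L with
  | nil => simp
  | cons i L ih =>
    rw [List.map_cons, List.prod_cons, map_mul, ih, SymmetricAlgebra.equivMvPolynomial_ι_apply,
      MvPolynomial.X, MvPolynomial.monomial_mul, one_mul, ← Multiset.cons_coe,
      ← Multiset.singleton_add, map_add, Multiset.toFinsupp_singleton]

/-- The coefficient of the monomial `b_{u_1} ⋯ b_{u_m}` in an element of `Sym(V)`. -/
def symCoeff (u : List (Fin n)) : SymmetricAlgebra 𝕜 V →ₗ[𝕜] 𝕜 :=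
  MvPolynomial.lcoeff 𝕜 (Multiset.toFinsupp (u : Multiset (Fin n))) ∘ₗ
    (SymmetricAlgebra.equivMvPolynomial b).toLinearMap

theorem symCoeff_prod_map (u L : List (Fin n)) [Decidable (L.Perm u)] :
    symCoeff b u (L.map fun i => SymmetricAlgebra.ι 𝕜 V (b i)).prod =
      if L.Perm u then 1 else 0 := by
  classical
  change MvPolynomial.coeff _ (SymmetricAlgebra.equivMvPolynomial b _) = _
  rw [equivMvPolynomial_prod_map, MvPolynomial.coeff_monomial]
  refine if_congr ?_ rfl rfl
  rw [Multiset.toFinsupp.injective.eq_iff, Multiset.coe_eq_coe]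

/-- The coefficient of `b_{u_1} ∧ ⋯ ∧ b_{u_m}` in an element of `Λ(V)`, as a determinant of
coordinates. -/
def extCoeff (u : List (Fin n)) : ExteriorAlgebra 𝕜 V →ₗ[𝕜] 𝕜 :=
  ExteriorAlgebra.liftAlternating fun i =>
    if h : i = u.length then
      Matrix.detRowAlternating.compLinearMap
        (LinearMap.pi fun l : Fin i => b.coord (u.get (Fin.cast h l)))
    else 0

theorem extCoeff_prod_map (u L : List (Fin n)) (h : L.length = u.length) :
    extCoeff b u (L.map fun i => ExteriorAlgebra.ι 𝕜 (b i)).prod =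
      Matrix.det (Matrix.of fun k l : Fin L.length =>
        if L.get k = u.get (Fin.cast h l) then (1 : 𝕜) else 0) := by
  have hL : (L.map fun i => ExteriorAlgebra.ι 𝕜 (b i)).prod =
      ExteriorAlgebra.ιMulti 𝕜 L.length fun k => b (L.get k) := by
    rw [ExteriorAlgebra.ιMulti_apply]
    congr 1
    conv_lhs => rw [← List.ofFn_get L, List.map_ofFn]
    rfl
  rw [hL, extCoeff, ExteriorAlgebra.liftAlternating_apply_ιMulti, dif_pos h]
  change Matrix.det _ = _
  congr 1
  ext k l
  simp [Finsupp.single_apply]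

theorem extCoeff_prod_map_of_length_ne (u L : List (Fin n)) (h : L.length ≠ u.length) :
    extCoeff b u (L.map fun i => ExteriorAlgebra.ι 𝕜 (b i)).prod = 0 := by
  have hL : (L.map fun i => ExteriorAlgebra.ι 𝕜 (b i)).prod =
      ExteriorAlgebra.ιMulti 𝕜 L.length fun k => b (L.get k) := by
    rw [ExteriorAlgebra.ιMulti_apply]
    congr 1
    conv_lhs => rw [← List.ofFn_get L, List.map_ofFn]
    rfl
  rw [hL, extCoeff, ExteriorAlgebra.liftAlternating_apply_ιMulti, dif_neg h]
  rfl

theorem extCoeff_prod_map_self {u : List (Fin n)} (hu : u.Nodup) :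
    extCoeff b u (u.map fun i => ExteriorAlgebra.ι 𝕜 (b i)).prod = 1 := by
  rw [extCoeff_prod_map b u u rfl]
  convert Matrix.det_one (n := Fin u.length) (R := 𝕜) using 2
  ext k l
  simp [Matrix.one_apply, hu.getElem_inj_iff, Fin.ext_iff]

theorem perm_of_extCoeff_ne_zero {u L : List (Fin n)} (hu : u.Nodup)
    (h : extCoeff b u (L.map fun i => ExteriorAlgebra.ι 𝕜 (b i)).prod ≠ 0) : L.Perm u := by
  by_cases hlen : L.length = u.length
  · rw [extCoeff_prod_map b u L hlen] at h
    have hsub : u ⊆ L := by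
      intro i hi
      obtain ⟨l, rfl⟩ := List.get_of_mem hi
      by_contra hL
      refine h (Matrix.det_eq_zero_of_column_eq_zero (Fin.cast hlen.symm l) fun k => ?_)
      rw [Matrix.of_apply, if_neg]
      exact fun e => hL (e ▸ List.get_mem L k)
    exact ((hu.subperm hsub).perm_of_length_le hlen.le).symm
  · exact absurd (extCoeff_prod_map_of_length_ne b u L hlen) h

end Functionals

/-! ### The cells of a skew shape, row by row -/

section Cells

open Equiv Finset

/-- The cells of `lam / mu`, as pairs of the number of a row and a position in that row. -/
abbrev Cell (lam mu : YoungDiagram) : Type :=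
  Σ i : Fin (lam.colLen 0), Fin (skewRowLen lam mu i)

variable {lam mu : YoungDiagram}

/-- The row of a cell. -/
def cellRow (c : Cell lam mu) : ℕ := c.1

/-- The column of a cell. -/
def cellCol (c : Cell lam mu) : ℕ := rowCol lam mu c.1 c.2

theorem cellCol_eq (c : Cell lam mu) : cellCol c = mu.rowLen c.1 + c.2 := rfl

theorem cell_ext (c d : Cell lam mu) (hr : cellRow c = cellRow d) (hc : cellCol c = cellCol d) :
    c = d := by
  obtain ⟨i, k⟩ := c
  obtain ⟨i', k'⟩ := d
  have hi : i = i' := Fin.ext hr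
  subst hi
  have hk : k = k' := Fin.ext (by simpa [cellCol_eq] using hc)
  rw [hk]

theorem cellCol_lt (c : Cell lam mu) : cellCol c < lam.rowLen (cellRow c) := by
  have := c.2.2
  rw [cellCol_eq, cellRow]
  unfold skewRowLen at this
  omega

theorem le_cellCol (c : Cell lam mu) : mu.rowLen (cellRow c) ≤ cellCol c := by
  rw [cellCol_eq, cellRow]
  omega

theorem exists_cell {i : ℕ} (hi : i < lam.colLen 0) {v : ℕ} (h1 : mu.rowLen i ≤ v)
    (h2 : v < lam.rowLen i) : ∃ c : Cell lam mu, cellRow c = i ∧ cellCol c = v := by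
  refine ⟨⟨⟨i, hi⟩, ⟨v - mu.rowLen i, ?_⟩⟩, rfl, ?_⟩
  · unfold skewRowLen
    dsimp only
    omega
  · rw [cellCol_eq]
    dsimp only
    omega

/-- The pigeonhole principle behind the Garnir relation. Let `c` and `d` be cells of one column, `c`
above `d`. The cells of the row of `c` from `c` on and those of the row of `d` up to `d` together
number one more than the columns met by these two rows, so among equally many cells of the two
rows two lie in a common column. -/
theorem exists_same_col (c d : Cell lam mu) (hr : cellRow c < cellRow d)
    (hc : cellCol c = cellCol d) (Z : Finset (Cell lam mu))
    (hZ : #(univ.filter fun x : Cell lam mu => cellRow x = cellRow c ∧ cellCol c ≤ cellCol x) +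
        #(univ.filter fun x : Cell lam mu => cellRow x = cellRow d ∧ cellCol x ≤ cellCol d) = #Z)
    (hZ' : ∀ z ∈ Z, cellRow z = cellRow c ∨ cellRow z = cellRow d) :
    ∃ z ∈ Z, ∃ z' ∈ Z, z ≠ z' ∧ cellCol z = cellCol z' := by
  have hX : Ico (cellCol c) (lam.rowLen (cellRow c)) ⊆
      (univ.filter fun x : Cell lam mu => cellRow x = cellRow c ∧ cellCol c ≤ cellCol x).image
        cellCol := by
    intro v hv
    obtain ⟨h1, h2⟩ := mem_Ico.1 hv
    obtain ⟨x, hx, rfl⟩ := exists_cell (mu := mu) c.1.2 ((le_cellCol c).trans h1) h2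
    exact mem_image_of_mem _ (mem_filter.2 ⟨mem_univ _, hx, h1⟩)
  have hY : Ico (mu.rowLen (cellRow d)) (cellCol d + 1) ⊆
      (univ.filter fun x : Cell lam mu => cellRow x = cellRow d ∧ cellCol x ≤ cellCol d).image
        cellCol := by
    intro v hv
    obtain ⟨h1, h2⟩ := mem_Ico.1 hv
    have := cellCol_lt d
    obtain ⟨x, hx, rfl⟩ := exists_cell (mu := mu) d.1.2 h1 (lt_of_lt_of_le h2 this)
    exact mem_image_of_mem _ (mem_filter.2 ⟨mem_univ _, hx, Nat.lt_succ_iff.1 h2⟩)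
  have hX' := (card_le_card hX).trans card_image_le
  have hY' := (card_le_card hY).trans card_image_le
  rw [Nat.card_Ico] at hX' hY'
  have hlam := lam.rowLen_anti _ _ hr.le
  have hmu := mu.rowLen_anti _ _ hr.le
  have h1 := cellCol_lt c
  have h2 := le_cellCol d
  obtain ⟨z, hz, z', hz', hne, e⟩ := Finset.exists_ne_map_eq_of_card_lt_of_maps_to
    (s := Z) (t := Ico (mu.rowLen (cellRow d)) (lam.rowLen (cellRow c)))
    (by rw [Nat.card_Ico]; omega) (f := cellCol) (fun z hz => by
      have h3 := cellCol_lt z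
      have h4 := le_cellCol z
      refine Finset.mem_coe.2 (mem_Ico.2 ?_)
      rcases hZ' z hz with h | h <;> rw [h] at h3 h4 <;> constructor <;> omega)
  exact ⟨z, hz, z', hz', hne, e⟩

variable (lam mu) in
/-- All cells, in the order in which they are read along the rows. -/
def cellList : List (Cell lam mu) :=
  (List.finRange (lam.colLen 0)).sigma fun i => List.finRange (skewRowLen lam mu i)

theorem nodup_cellList : (cellList lam mu).Nodup :=
  (List.nodup_finRange _).sigma fun _ => List.nodup_finRange _

theorem mem_cellList (c : Cell lam mu) : c ∈ cellList lam mu :=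
  List.mem_sigma.2 ⟨List.mem_finRange _, List.mem_finRange _⟩

variable (lam mu) in
/-- The cells as positions in the rows and as elements of the diagram. -/
def cellEquiv : Cell lam mu ≃ SkewCell lam mu :=
  Equiv.ofBijective (fun c => rowCell lam mu c.1 c.2) (by
    constructor
    · intro c d h
      have h' := congrArg Subtype.val h
      exact cell_ext c d (congrArg Prod.fst h') (congrArg Prod.snd h')
    · rintro ⟨⟨i, j⟩, h1, h2⟩
      have hi : i < lam.colLen 0 :=
        YoungDiagram.mem_iff_lt_colLen.1 (lam.up_left_mem le_rfl (Nat.zero_le j) h1)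
      rw [YoungDiagram.mem_iff_lt_rowLen] at h1 h2
      obtain ⟨c, hc, hc'⟩ := exists_cell (mu := mu) hi (not_lt.1 h2) h1
      exact ⟨c, Subtype.ext (Prod.ext hc hc')⟩)

theorem card_cell (hle : mu ≤ lam) {r : ℕ} (hr : lam.card = mu.card + r) :
    Fintype.card (Cell lam mu) = r := by
  have h : Fintype.card (Cell lam mu) = #(lam.cells \ mu.cells) := by
    rw [← Fintype.card_coe]
    refine Fintype.card_congr ((cellEquiv lam mu).trans (Equiv.subtypeEquivRight fun c => ?_))
    rw [Finset.mem_sdiff, YoungDiagram.mem_cells, YoungDiagram.mem_cells]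
  rw [h, Finset.card_sdiff_of_subset (YoungDiagram.cells_subset_iff.2 hle)]
  unfold YoungDiagram.card at hr
  omega

variable (lam mu) in
/-- Semistandard tableaux with distinct entries are standard fillings. -/
def tableauEquiv (n : ℕ) : DistinctTableau lam mu n ≃
    {T : Cell lam mu → Fin n // IsStandard cellRow cellCol T} where
  toFun T := ⟨T.entry ∘ cellEquiv lam mu, fun c d h1 h2 => T.row_strict _ _ h1 h2,
    fun c d h1 h2 => lt_of_le_of_ne (T.col_weak _ _ h1 h2) fun e => by
      rw [(cellEquiv lam mu).injective (T.distinct e)] at h2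
      exact lt_irrefl _ h2,
    T.distinct.comp (cellEquiv lam mu).injective⟩
  invFun T :=
    { entry := T.1 ∘ (cellEquiv lam mu).symm
      row_strict := fun c d h1 h2 => by
        obtain ⟨c, rfl⟩ := (cellEquiv lam mu).surjective c
        obtain ⟨d, rfl⟩ := (cellEquiv lam mu).surjective d
        simpa using T.2.1 c d h1 h2
      col_weak := fun c d h1 h2 => by
        obtain ⟨c, rfl⟩ := (cellEquiv lam mu).surjective c
        obtain ⟨d, rfl⟩ := (cellEquiv lam mu).surjective d
        simpa using (T.2.2.1 c d h1 h2).le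
      distinct := T.2.2.2.comp (cellEquiv lam mu).symm.injective }
  left_inv T := by
    ext c
    simp
  right_inv T := by
    ext c
    simp

theorem prod_map_sigma {α B : Type*} {σ : α → Type*} [Monoid B] (l : List α)
    (l' : ∀ i, List (σ i)) (f : (Σ i, σ i) → B) :
    ((l.sigma l').map f).prod = (l.map fun i => ((l' i).map fun k => f ⟨i, k⟩).prod).prod := by
  induction l with
  | nil => rfl
  | cons i l ih =>
    rw [List.sigma_cons, List.map_append, List.prod_append, ih, List.map_cons, List.prod_cons,
      List.map_map]
    rfl

variable {𝕜 : Type*} [Field 𝕜] {V : Type*} [AddCommGroup V] [Module 𝕜 V]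
variable {B : Type*} [Ring B] [Algebra 𝕜 B]

/-- Placing the factors of the rows into their columns multiplies the vectors of each column from
top to bottom, because the cells are read row by row. -/
theorem placeRows_tprod (ι : V →ₗ[𝕜] B) {n : ℕ} (e : Fin n → V) (w : Cell lam mu → Fin n) :
    placeRows ι (fun i : Fin (lam.colLen 0) => skewRowLen lam mu i) (fun i => rowCol lam mu i)
        (PiTensorProduct.tprod 𝕜 fun i => PiTensorProduct.tprod 𝕜 fun k => e (w ⟨i, k⟩)) =
      bracket ι e (fun c => rowCol lam mu c.1 c.2) (cellList lam mu) w := by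
  rw [bracket, cellList, prod_map_sigma]
  simp only [placeRows, placeRow, PiTensorProduct.lift.tprod, MultilinearMap.compLinearMap_apply,
    MultilinearMap.mkPiAlgebraFin_apply, List.ofFn_eq_map]
  rfl

/-- A row preserving permutation of the cells is a family of permutations of the single rows. -/
theorem rowSum_cell {n : ℕ} {W : Type*} [AddCommGroup W] (χ : Perm (Cell lam mu) →* ℤˣ)
    (br : (Cell lam mu → Fin n) → W) (T : Cell lam mu → Fin n) :
    rowSum cellRow χ br T =
      ∑ p : ∀ i : Fin (lam.colLen 0), Perm (Fin (skewRowLen lam mu i)),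
        χ (Equiv.sigmaCongrRight p) • br fun c => T ⟨c.1, p c.1 c.2⟩ := by
  rw [rowSum]
  refine (Finset.sum_bij (fun p _ => ⟨Equiv.sigmaCongrRight p, fun _ => rfl⟩) ?_ ?_ ?_ ?_).symm
  · intro p _
    exact mem_univ _
  · intro p _ p' _ h
    exact Perm.sigmaCongrRightHom_injective (congrArg Subtype.val h)
  · rintro ⟨σ, hσ⟩ _
    have hσ1 : ∀ c, (σ c).1 = c.1 := fun c => Fin.ext (hσ c)
    have hex : ∀ (i : Fin (lam.colLen 0)) (k : Fin (skewRowLen lam mu i)),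
        ∃ k', σ ⟨i, k⟩ = ⟨i, k'⟩ := by
      intro i k
      have := hσ1 ⟨i, k⟩
      generalize σ ⟨i, k⟩ = c at this
      obtain ⟨i', k'⟩ := c
      cases this
      exact ⟨k', rfl⟩
    choose f hf using hex
    have hinj : ∀ i, Function.Injective (f i) := by
      intro i k k' h
      have := σ.injective ((hf i k).trans (h ▸ (hf i k').symm))
      simpa using this
    refine ⟨fun i => Equiv.ofBijective (f i) (Finite.injective_iff_bijective.1 (hinj i)),
      mem_univ _, Subtype.ext (Equiv.ext fun c => ?_)⟩
    exact (hf c.1 c.2).symm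
  · intro p _
    rfl

end Cells

/-! ### The standard system of a Schur or Weyl module -/

section System

open Equiv

variable {𝕜 : Type*} [Field 𝕜] {lam mu : YoungDiagram} {n : ℕ}
variable {B : Type*} [Ring B] [Algebra 𝕜 B] {ι : (Fin n → 𝕜) →ₗ[𝕜] B}

variable (lam mu) (ι) in
/-- The product of the standard basis vectors numbered by the entries of a filling, each placed in
the factor of its column. -/
def cellBracket (w : Cell lam mu → Fin n) : ⨂[𝕜] (_ : Fin (lam.rowLen 0)), B :=
  bracket ι (Pi.basisFun 𝕜 (Fin n)) (fun c => rowCol lam mu c.1 c.2) (cellList lam mu) w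

theorem tensorAlgHom_cellBracket {F : B →ₐ[𝕜] B} {t : Fin n → 𝕜ˣ}
    (hF : ∀ v, F (ι v) = ι ((Matrix.diagonal fun i => (t i : 𝕜)).toLin' v))
    (w : Cell lam mu → Fin n) :
    tensorAlgHom (lam.rowLen 0) F (cellBracket lam mu ι w) =
      weightChar 𝕜 (content w) t • cellBracket lam mu ι w := by
  have hfac : ∀ c : Cell lam mu, tensorAlgHom (lam.rowLen 0) F
      (PiTensorProduct.singleAlgHom (R := 𝕜) (A := fun _ : Fin (lam.rowLen 0) => B)
        (rowCol lam mu c.1 c.2) (ι (Pi.basisFun 𝕜 (Fin n) (w c)))) =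
      (t (w c) : 𝕜) • PiTensorProduct.singleAlgHom (R := 𝕜)
        (A := fun _ : Fin (lam.rowLen 0) => B)
        (rowCol lam mu c.1 c.2) (ι (Pi.basisFun 𝕜 (Fin n) (w c))) := by
    intro c
    have hv : (Matrix.diagonal fun i => (t i : 𝕜)).toLin' (Pi.basisFun 𝕜 (Fin n) (w c)) =
        (t (w c) : 𝕜) • Pi.basisFun 𝕜 (Fin n) (w c) := by
      ext i
      by_cases hi : i = w c
      · subst hi
        simp
      · simp [hi]
    rw [← map_smul, ← map_smul, ← hv, ← hF, PiTensorProduct.singleAlgHom_apply,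
      PiTensorProduct.singleAlgHom_apply, tensorAlgHom_tprod]
    congr 1
    funext j
    by_cases hj : j = rowCol lam mu c.1 c.2
    · subst hj; simp
    · simp [hj]
  have hlist : ∀ l : List (Cell lam mu), tensorAlgHom (lam.rowLen 0) F
      (bracket ι (Pi.basisFun 𝕜 (Fin n)) (fun c => rowCol lam mu c.1 c.2) l w) =
      (l.map fun c => (t (w c) : 𝕜)).prod •
        bracket ι (Pi.basisFun 𝕜 (Fin n)) (fun c => rowCol lam mu c.1 c.2) l w := by
    intro l
    induction l with
    | nil => simp [bracket]
    | cons c l ih =>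
      simp only [bracket, List.map_cons, List.prod_cons, map_mul] at ih ⊢
      rw [ih, hfac, smul_mul_smul_comm]
  rw [cellBracket, hlist, ← prod_comp_eq_weightChar]
  congr 1
  rw [← List.prod_toFinset _ nodup_cellList]
  congr 1
  ext c
  simp [mem_cellList]

/-- The vectors `x T` of a subrepresentation `j : M → B ⊗ ⋯ ⊗ B` form a standard system if they are
combinations of the products of basis vectors with the same content, and for injective `T` are the
signed sums over the row permutations of such products. -/
theorem standardSystem_of_rowSum {M : Type*} [AddCommGroup M] [Module 𝕜 M]
    (j : M →ₗ[𝕜] ⨂[𝕜] (_ : Fin (lam.rowLen 0)), B) (hj : Function.Injective j)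
    {ρ : Representation 𝕜 (Matrix (Fin n) (Fin n) 𝕜) M} {x : (Cell lam mu → Fin n) → M}
    {ε : 𝕜} {χ : Perm (Cell lam mu) →* ℤˣ} {F : Matrix (Fin n) (Fin n) 𝕜 → B →ₐ[𝕜] B}
    {Ψ : List (Fin n) → B →ₗ[𝕜] 𝕜}
    (hι : ∀ u v, ι u * ι v = ε • (ι v * ι u))
    (hχ : ∀ c d, c ≠ d → (((χ (swap c d) : ℤˣ) : ℤ) : 𝕜) = -ε)
    (hF : ∀ A v, F A (ι v) = ι (A.toLin' v))
    (hρ : ∀ A y, j (ρ A y) = tensorAlgHom _ (F A) (j y))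
    (hΨ1 : ∀ u : List (Fin n), u.Nodup →
      Ψ u (u.map fun i => ι (Pi.basisFun 𝕜 (Fin n) i)).prod = 1)
    (hΨ2 : ∀ u L : List (Fin n), u.Nodup →
      Ψ u (L.map fun i => ι (Pi.basisFun 𝕜 (Fin n) i)).prod ≠ 0 → L.Perm u)
    (hspan : ⊤ ≤ Submodule.span 𝕜 (Set.range x))
    (hx : ∀ T, j (x T) ∈
      Submodule.span 𝕜 (cellBracket lam mu ι '' {w | content w = content T}))
    (hx' : ∀ T, Function.Injective T →
      j (x T) = rowSum cellRow χ (cellBracket lam mu ι) T) :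
    StandardSystem ρ x (IsStandard cellRow cellCol) where
  span := hspan
  weight T t := by
    refine hj ?_
    rw [hρ, map_smul, ← weightChar_apply]
    have hmem := hx T
    generalize j (x T) = z at hmem ⊢
    induction hmem using Submodule.span_induction with
    | mem y hy =>
      obtain ⟨w, hw, rfl⟩ := hy
      rw [tensorAlgHom_cellBracket (hF _), show content w = content T from hw]
    | zero => simp
    | add y z _ _ hy hz => rw [map_add, hy, hz, smul_add]
    | smul a y _ hy => rw [map_smul, hy, smul_comm]
  injective T hT := hT.2.2
  straighten T hT := by
    have h := rowSum_mem_span_standard (R := 𝕜) (row := cellRow) (col := cellCol) cell_ext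
      (χ := χ) (br := cellBracket lam mu ι) (fun T c d hne hcol => by
        rw [cellBracket, bracket_swap hι _ nodup_cellList T (mem_cellList c) (mem_cellList d) hne
          (Fin.ext hcol), Units.smul_def, ← Int.cast_smul_eq_zsmul 𝕜, hχ c d hne, neg_smul, neg_neg]
        rfl) exists_same_col T hT
    rw [← hx' T hT] at h
    have himage : {y | ∃ S, IsStandard cellRow cellCol S ∧ (∃ σ : Perm (Cell lam mu), S = T ∘ σ) ∧
        y = rowSum cellRow χ (cellBracket lam mu ι) S} = j '' {y | ∃ S,
          IsStandard cellRow cellCol S ∧ (∃ σ : Perm (Cell lam mu), S = T ∘ σ) ∧ y = x S} := by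
      ext y
      constructor
      · rintro ⟨S, hS, hσ, rfl⟩
        exact ⟨x S, ⟨S, hS, hσ, rfl⟩, hx' S hS.2.2⟩
      · rintro ⟨_, ⟨S, hS, hσ, rfl⟩, rfl⟩
        exact ⟨S, hS, hσ, hx' S hS.2.2⟩
    rw [himage, Submodule.span_image] at h
    obtain ⟨y, hy, e⟩ := h
    rwa [hj e] at hy
  triangular := by
    have hΦ : ∀ T : Cell lam mu → Fin n, Function.Injective T → ∀ w,
        colFunctional Ψ (fun c => rowCol lam mu c.1 c.2) (cellList lam mu) T
          (cellBracket lam mu ι w) ≠ 0 → ∃ τ ∈ labelGroup (cellCol (lam := lam) (mu := mu)),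
            w = T ∘ τ :=
      fun T hT w h => exists_comp_of_colFunctional_ne_zero hΨ2 _ nodup_cellList mem_cellList hT h
    refine ⟨fun T => colFunctional Ψ (fun c => rowCol lam mu c.1 c.2) (cellList lam mu) T ∘ₗ
      j, colMeasure (lam.rowLen 0) cellCol, ?_, ?_, ?_⟩
    · intro T hT
      rw [LinearMap.comp_apply, hx' T hT.2.2,
        apply_rowSum_self cell_ext hT.2.2 _ (hΦ T hT.2.2)]
      exact colFunctional_bracket_self hΨ1 _ nodup_cellList hT.2.2
    · intro T S hT hS h
      rw [LinearMap.comp_apply, hx' S hS.2.2] at h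
      exact eq_or_colMeasure_lt cell_ext _ (hΦ T hT.2.2) hT hS
        (fun c => (rowCol lam mu c.1 c.2).2.le) h
    · intro T S hT h
      by_contra hS
      refine h ?_
      have hle : Submodule.span 𝕜 (cellBracket lam mu ι '' {w | content w = content S}) ≤
          LinearMap.ker (colFunctional Ψ (fun c => rowCol lam mu c.1 c.2) (cellList lam mu) T) := by
        rw [Submodule.span_le]
        rintro _ ⟨w, hw, rfl⟩
        rw [SetLike.mem_coe, LinearMap.mem_ker]
        by_contra hw0
        obtain ⟨τ, -, rfl⟩ := hΦ T hT.2.2 w hw0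
        rw [injective_iff_content_le_one, ← show content (T ∘ τ) = content S from hw,
          ← injective_iff_content_le_one] at hS
        exact hS (hT.2.2.comp τ.injective)
      exact LinearMap.mem_ker.1 (hle (hx S))

end System

/-! ### The sign of a permutation acting separately on the rows -/

section Sign

open Equiv

variable {I : Type*} [DecidableEq I] {β : I → Type*} [∀ i, DecidableEq (β i)]

theorem sigmaCongrRight_mulSingle_swap (i : I) (a b : β i) :
    Equiv.sigmaCongrRight (Pi.mulSingle i (swap a b) : ∀ i, Perm (β i)) =
      swap (⟨i, a⟩ : Σ i, β i) ⟨i, b⟩ := by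
  refine Equiv.ext fun ⟨j, k⟩ => ?_
  rw [Equiv.sigmaCongrRight_apply]
  by_cases hj : j = i
  · subst hj
    simp only [Pi.mulSingle_eq_same]
    rw [swap_apply_def, swap_apply_def]
    simp only [Sigma.mk.injEq, heq_eq_eq, true_and]
    split_ifs <;> rfl
  · rw [swap_apply_of_ne_of_ne (fun h => hj (congrArg Sigma.fst h))
      (fun h => hj (congrArg Sigma.fst h))]
    simp [Pi.mulSingle_eq_of_ne hj]

theorem sign_sigmaCongrRight [Fintype I] [∀ i, Fintype (β i)] (p : ∀ i, Perm (β i)) :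
    Perm.sign (Equiv.sigmaCongrRight p) = ∏ i, Perm.sign (p i) := by
  let f : (∀ i, Perm (β i)) →* ℤˣ := Perm.sign.comp (Perm.sigmaCongrRightHom β)
  let g : (∀ i, Perm (β i)) →* ℤˣ := ∏ i, Perm.sign.comp (Pi.evalMonoidHom _ i)
  suffices h : f = g by
    have := DFunLike.congr_fun h p
    simpa [f, g, MonoidHom.finsetProd_apply] using this
  refine MonoidHom.pi_ext fun i σ => ?_
  have hg : ∀ σ : Perm (β i), g (Pi.mulSingle i σ) = Perm.sign σ := by
    intro σ
    simp only [g, MonoidHom.finsetProd_apply, MonoidHom.comp_apply, Pi.evalMonoidHom_apply]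
    rw [Finset.prod_eq_single i]
    · rw [Pi.mulSingle_eq_same]
    · intro j _ hj
      rw [Pi.mulSingle_eq_of_ne hj, map_one]
    · exact fun h => absurd (Finset.mem_univ i) h
  rw [hg]
  induction σ using Perm.swap_induction_on with
  | one => rw [Pi.mulSingle_one, map_one, map_one]
  | swap_mul σ a b hab ih =>
    rw [Pi.mulSingle_mul, map_mul, ih, map_mul]
    congr 1
    change Perm.sign (Equiv.sigmaCongrRight _) = _
    rw [sigmaCongrRight_mulSingle_swap, Perm.sign_swap hab, Perm.sign_swap]
    exact fun h => hab (by simpa using h)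

end Sign

/-! ### Spanning sets of tensor products -/

section Spanning

variable {𝕜 : Type*} [Field 𝕜] {I : Type*} [Fintype I] {E : I → Type*}
  [∀ i, AddCommGroup (E i)] [∀ i, Module 𝕜 (E i)] {W : Type*} [AddCommMonoid W] [Module 𝕜 W]
  {κ : I → Type*} [∀ i, Fintype (κ i)] {v : ∀ i, κ i → E i}

theorem multilinear_mem_of_span (hv : ∀ i, ⊤ ≤ Submodule.span 𝕜 (Set.range (v i)))
    (f : MultilinearMap 𝕜 E W) (U : Submodule 𝕜 W)
    (hU : ∀ p : ∀ i, κ i, f (fun i => v i (p i)) ∈ U) (x : ∀ i, E i) : f x ∈ U := by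
  classical
  have h : ∀ i, ∃ c : κ i → 𝕜, ∑ j, c j • v i j = x i := fun i =>
    (Submodule.mem_span_range_iff_exists_fun 𝕜).1 (hv i Submodule.mem_top)
  choose c hc using h
  rw [← funext hc, f.map_sum]
  refine Submodule.sum_mem _ fun p _ => ?_
  rw [f.map_smul_univ]
  exact U.smul_mem _ (hU p)

theorem tensor_mem_of_span (hv : ∀ i, ⊤ ≤ Submodule.span 𝕜 (Set.range (v i)))
    (g : (⨂[𝕜] i, E i) →ₗ[𝕜] W) (U : Submodule 𝕜 W)
    (hU : ∀ p : ∀ i, κ i, g (PiTensorProduct.tprod 𝕜 fun i => v i (p i)) ∈ U)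
    (z : ⨂[𝕜] i, E i) : g z ∈ U := by
  have h : (⊤ : Submodule 𝕜 (⨂[𝕜] i, E i)) ≤ U.comap g := by
    rw [← PiTensorProduct.span_tprod_eq_top, Submodule.span_le]
    rintro _ ⟨x, rfl⟩
    exact multilinear_mem_of_span hv (g.compMultilinearMap (PiTensorProduct.tprod 𝕜)) U hU x
  exact h Submodule.mem_top

theorem exteriorPower_span_basis {V : Type*} [AddCommGroup V] [Module 𝕜 V] {n : ℕ}
    (b : Basis (Fin n) 𝕜 V) (m : ℕ) :
    ⊤ ≤ Submodule.span 𝕜 (Set.range fun u : Fin m → Fin n =>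
      exteriorPower.ιMulti 𝕜 m fun k => b (u k)) := by
  rw [← exteriorPower.ιMulti_span 𝕜 m V, Submodule.span_le]
  rintro _ ⟨x, rfl⟩
  exact multilinear_mem_of_span (fun _ => b.span_eq.ge)
    (exteriorPower.ιMulti 𝕜 m).toMultilinearMap
    (Submodule.span 𝕜 (Set.range fun u : Fin m → Fin n =>
      exteriorPower.ιMulti 𝕜 m fun k => b (u k)))
    (fun p => Submodule.subset_span ⟨p, rfl⟩) x

end Spanning

/-! ### Divided powers -/

section Divided

variable {𝕜 : Type*} [Field 𝕜] {V : Type*} [AddCommGroup V] [Module 𝕜 V] {n : ℕ}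
  (b : Basis (Fin n) 𝕜 V)

/-- The exponents of the monomial belonging to a word in `[n]`. -/
def wordContent {m : ℕ} (u : Fin m → Fin n) : Fin n →₀ ℕ := ∑ k, Finsupp.single (u k) 1

theorem wordContent_apply {m : ℕ} (u : Fin m → Fin n) (i : Fin n) :
    wordContent u i = content u i := by
  rw [wordContent, content, Finset.card_filter, Finsupp.finsetSum_apply]
  exact Finset.sum_congr rfl fun k _ => Finsupp.single_apply

theorem equivMvPolynomial_symMul (b : Basis (Fin n) 𝕜 V) {m : ℕ} (u : Fin m → Fin n) :
    SymmetricAlgebra.equivMvPolynomial b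
        (symMul 𝕜 V m (PiTensorProduct.tprod 𝕜 fun k => b (u k)) : SymmetricAlgebra 𝕜 V) =
      MvPolynomial.monomial (wordContent u) 1 := by
  rw [symMul, PiTensorProduct.lift.tprod]
  change SymmetricAlgebra.equivMvPolynomial b (∏ k, SymmetricAlgebra.ι 𝕜 V (b (u k))) = _
  rw [map_prod, wordContent, MvPolynomial.monomial_sum_one]
  exact Finset.prod_congr rfl fun k _ => SymmetricAlgebra.equivMvPolynomial_ι_apply _ _

theorem dividedMonomial_symMul {m : ℕ} (a : Fin n →₀ ℕ)
    (u : Fin m → Fin n) :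
    dividedMonomial 𝕜 b m a (symMul 𝕜 (Dual 𝕜 V) m
      (PiTensorProduct.tprod 𝕜 fun k => b.dualBasis (u k))) =
      if wordContent u = a then 1 else 0 := by
  change MvPolynomial.coeff a (SymmetricAlgebra.equivMvPolynomial b.dualBasis
    (symMul 𝕜 (Dual 𝕜 V) m (PiTensorProduct.tprod 𝕜 fun k => b.dualBasis (u k)) :
      SymmetricAlgebra 𝕜 (Dual 𝕜 V))) = _
  rw [equivMvPolynomial_symMul, MvPolynomial.coeff_monomial]

theorem symMul_surjective (b : Basis (Fin n) 𝕜 V) (m : ℕ) : Function.Surjective (symMul 𝕜 V m) := by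
  have hrange : LinearMap.range (SymmetricAlgebra.ι 𝕜 V) =
      Submodule.span 𝕜 (Set.range fun i => SymmetricAlgebra.ι 𝕜 V (b i)) := by
    rw [LinearMap.range_eq_map, ← b.span_eq, Submodule.map_span, ← Set.range_comp]
    rfl
  have hle : symPower 𝕜 V m ≤ LinearMap.range ((symPower 𝕜 V m).subtype ∘ₗ symMul 𝕜 V m) := by
    conv_lhs => rw [symPower, hrange, Submodule.span_pow]
    rw [Submodule.span_le]
    intro y hy
    obtain ⟨f, rfl⟩ := Set.mem_pow.1 hy
    choose u hu using fun k => (f k).2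
    refine ⟨PiTensorProduct.tprod 𝕜 fun k => b (u k), ?_⟩
    rw [LinearMap.comp_apply, symMul, PiTensorProduct.lift.tprod, List.prod_ofFn]
    change ∏ k, SymmetricAlgebra.ι 𝕜 V (b (u k)) = _
    exact Finset.prod_congr rfl fun k _ => hu k
  intro y
  obtain ⟨z, hz⟩ := hle y.2
  exact ⟨z, Subtype.ext hz⟩

theorem dividedPower_ext {m : ℕ} {φ ψ : DividedPower 𝕜 V m}
    (h : ∀ u : Fin m → Fin n, φ (symMul 𝕜 (Dual 𝕜 V) m
      (PiTensorProduct.tprod 𝕜 fun k => b.dualBasis (u k))) = ψ (symMul 𝕜 (Dual 𝕜 V) m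
      (PiTensorProduct.tprod 𝕜 fun k => b.dualBasis (u k)))) : φ = ψ := by
  rw [← LinearMap.cancel_right (symMul_surjective b.dualBasis m)]
  refine (Basis.piTensorProduct fun _ : Fin m => b.dualBasis).ext fun u => ?_
  rw [Basis.piTensorProduct_apply]
  exact h u

theorem dividedMonomial_span (m : ℕ) :
    ⊤ ≤ Submodule.span 𝕜 (Set.range fun u : Fin m → Fin n =>
      dividedMonomial 𝕜 b m (wordContent u)) := by
  classical
  intro φ _
  let s : (Fin m → Fin n) → symPower 𝕜 (Dual 𝕜 V) m := fun u =>
    symMul 𝕜 (Dual 𝕜 V) m (PiTensorProduct.tprod 𝕜 fun k => b.dualBasis (u k))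
  -- The monomial of a word depends only on its content, hence so does the value of `φ` at it.
  have hs : ∀ u u', wordContent u = wordContent u' → s u = s u' := by
    intro u u' h
    refine Subtype.ext ((SymmetricAlgebra.equivMvPolynomial b.dualBasis).injective ?_)
    rw [equivMvPolynomial_symMul, equivMvPolynomial_symMul, h]
  let g : (Fin n →₀ ℕ) → 𝕜 := fun a =>
    if h : ∃ u : Fin m → Fin n, wordContent u = a then φ (s h.choose) else 0
  have hg : ∀ u, g (wordContent u) = φ (s u) := by
    intro u
    have h : ∃ u' : Fin m → Fin n, wordContent u' = wordContent u := ⟨u, rfl⟩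
    simp only [g, dif_pos h]
    rw [hs _ _ h.choose_spec]
  have hφ : φ = ∑ a ∈ Finset.univ.image (wordContent : (Fin m → Fin n) → _),
      g a • dividedMonomial 𝕜 b m a := by
    refine dividedPower_ext b fun u => ?_
    rw [LinearMap.sum_apply]
    simp only [LinearMap.smul_apply, dividedMonomial_symMul, smul_eq_mul, mul_ite, mul_one,
      mul_zero]
    rw [Finset.sum_ite_eq, if_pos (Finset.mem_image_of_mem _ (Finset.mem_univ u)), hg]
  rw [hφ]
  refine Submodule.sum_mem _ fun a ha => Submodule.smul_mem _ _ ?_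
  obtain ⟨u, -, rfl⟩ := Finset.mem_image.1 ha
  exact Submodule.subset_span ⟨u, rfl⟩

/-- The comultiplication takes a divided monomial to the sum of all words with its exponents. -/
theorem dividedToTensor_dividedMonomial [FiniteDimensional 𝕜 V] (m : ℕ)
    (a : Fin n →₀ ℕ) :
    dividedToTensor 𝕜 V m (dividedMonomial 𝕜 b m a) =
      ∑ u : Fin m → Fin n with wordContent u = a, PiTensorProduct.tprod 𝕜 fun k => b (u k) := by
  apply (tensorEquivDual 𝕜 V m).injective
  rw [dividedToTensor, LinearMap.comp_apply, LinearEquiv.coe_coe, LinearEquiv.apply_symm_apply]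
  refine (Basis.piTensorProduct fun _ : Fin m => b.dualBasis).ext fun u => ?_
  rw [Basis.piTensorProduct_apply, LinearMap.dualMap_apply, dividedMonomial_symMul, map_sum,
    LinearMap.sum_apply]
  have h : ∀ u' : Fin m → Fin n, tensorEquivDual 𝕜 V m
      (PiTensorProduct.tprod 𝕜 fun k => b (u' k)) (PiTensorProduct.tprod 𝕜 fun k =>
        b.dualBasis (u k)) = if u = u' then 1 else 0 := by
    intro u'
    have : tensorEquivDual 𝕜 V m
      (PiTensorProduct.tprod 𝕜 fun k => b (u' k)) (PiTensorProduct.tprod 𝕜 fun k =>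
        b.dualBasis (u k)) = ∏ k, b.dualBasis (u k) (b (u' k)) := by
      simp [tensorEquivDual, PiTensorProduct.dualDistribEquiv,
        PiTensorProduct.dualDistribEquivOfBasis]
    rw [this]
    simp only [Basis.dualBasis_apply_self]
    split_ifs with h
    · subst h
      simp
    · obtain ⟨k, hk⟩ := Function.ne_iff.1 h
      exact Finset.prod_eq_zero (Finset.mem_univ k) (by simp [Ne.symm hk])
  simp only [h]
  rw [Finset.sum_ite_eq]
  simp

theorem exists_perm_of_wordContent_eq {m : ℕ} {u u' : Fin m → Fin n} (hu : Function.Injective u)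
    (h : wordContent u' = wordContent u) : ∃ σ : Equiv.Perm (Fin m), u' = u ∘ σ := by
  have h' : content u' = content u := by
    funext i
    rw [← wordContent_apply, h, wordContent_apply]
  have hmem : ∀ k, ∃ k', u k' = u' k := by
    intro k
    have hpos : 0 < content u' (u' k) :=
      Finset.card_pos.2 ⟨k, Finset.mem_filter.2 ⟨Finset.mem_univ k, rfl⟩⟩
    rw [h'] at hpos
    obtain ⟨k', hk'⟩ := Finset.card_pos.1 hpos
    exact ⟨k', (Finset.mem_filter.1 hk').2⟩
  choose σ hσ using hmem
  have hu' : Function.Injective u' := by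
    rwa [injective_iff_content_le_one, h', ← injective_iff_content_le_one]
  have hinj : Function.Injective σ := fun k k' e => hu' (by rw [← hσ k, ← hσ k', e])
  exact ⟨Equiv.ofBijective σ (Finite.injective_iff_bijective.1 hinj), funext fun k => (hσ k).symm⟩

/-- For distinct letters the words with given exponents are the rearrangements of one of them. -/
theorem dividedToTensor_dividedMonomial_of_injective [FiniteDimensional 𝕜 V] {m : ℕ}
    {u : Fin m → Fin n} (hu : Function.Injective u) :
    dividedToTensor 𝕜 V m (dividedMonomial 𝕜 b m (wordContent u)) =
      ∑ σ : Equiv.Perm (Fin m), PiTensorProduct.tprod 𝕜 fun k => b (u (σ k)) := by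
  classical
  rw [dividedToTensor_dividedMonomial]
  refine (Finset.sum_bij (fun (σ : Equiv.Perm (Fin m)) _ => u ∘ σ) ?_ ?_ ?_ ?_).symm
  · intro σ _
    refine Finset.mem_filter.2 ⟨Finset.mem_univ _, ?_⟩
    exact Equiv.sum_comp σ (fun k => Finsupp.single (u k) 1)
  · intro σ _ τ _ e
    exact Equiv.ext fun k => hu (congrFun e k)
  · intro u' hu'
    obtain ⟨σ, rfl⟩ := exists_perm_of_wordContent_eq hu (Finset.mem_filter.1 hu').2
    exact ⟨σ, Finset.mem_univ _, rfl⟩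
  · intro σ _
    rfl

end Divided

/-! ### Schur modules and Weyl modules -/

section SchurAndWeyl

open Equiv

variable {𝕜 : Type*} [Field 𝕜] {lam mu : YoungDiagram} {n : ℕ}
variable {B : Type*} [Ring B] [Algebra 𝕜 B] {ι : (Fin n → 𝕜) →ₗ[𝕜] B}

/-- If every row is expanded as a signed sum over its permutations, then placing the rows into the
columns gives the row sum over all row preserving permutations. -/
theorem placeRows_sum_perm (s : ∀ m, Perm (Fin m) →* ℤˣ) (χ : Perm (Cell lam mu) →* ℤˣ)
    (hχ : ∀ p : ∀ i : Fin (lam.colLen 0), Perm (Fin (skewRowLen lam mu i)),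
      χ (Equiv.sigmaCongrRight p) = ∏ i, s _ (p i)) (T : Cell lam mu → Fin n) :
    placeRows ι (fun i : Fin (lam.colLen 0) => skewRowLen lam mu i) (fun i => rowCol lam mu i)
        (PiTensorProduct.tprod 𝕜 fun i => ∑ σ : Perm (Fin (skewRowLen lam mu i)),
          s _ σ • PiTensorProduct.tprod 𝕜 fun k => Pi.basisFun 𝕜 (Fin n) (T ⟨i, σ k⟩)) =
      rowSum cellRow χ (cellBracket lam mu ι) T := by
  rw [MultilinearMap.map_sum, map_sum, rowSum_cell]
  refine Finset.sum_congr rfl fun p _ => ?_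
  have h : ∀ (m : ℕ) (u : ℤˣ) (z : ⨂[𝕜]^m (Fin n → 𝕜)), u • z = (((u : ℤˣ) : ℤ) : 𝕜) • z :=
    fun m u z => by
      rcases Int.units_eq_one_or u with rfl | rfl
      · simp
      · rw [Units.smul_def, Units.val_neg, Units.val_one, Int.cast_neg, Int.cast_one, neg_one_smul]
        exact (neg_one_smul 𝕜 z).symm
  simp only [h]
  rw [MultilinearMap.map_smul_univ, map_smul,
    placeRows_tprod ι (Pi.basisFun 𝕜 (Fin n)) (fun c => T ⟨c.1, p c.1 c.2⟩), hχ, Units.smul_def,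
    ← Int.cast_smul_eq_zsmul 𝕜]
  congr 1
  push_cast
  rfl

/-- The element `X_T`, for a filling `T` given row by row. -/
def rowsX (T : Cell lam mu → Fin n) : ExtRows 𝕜 (Fin n → 𝕜) lam mu :=
  PiTensorProduct.tprod 𝕜 fun i => exteriorPower.ιMulti 𝕜 (skewRowLen lam mu i) fun k =>
    Pi.basisFun 𝕜 (Fin n) (T ⟨i, k⟩)

theorem schurMap_rowsX (T : Cell lam mu → Fin n) :
    schurMap 𝕜 (Fin n → 𝕜) lam mu (rowsX T) =
      rowSum cellRow Perm.sign (cellBracket lam mu (SymmetricAlgebra.ι 𝕜 (Fin n → 𝕜))) T := by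
  rw [← placeRows_sum_perm (fun _ => Perm.sign) _ sign_sigmaCongrRight, schurMap, rowsX,
    LinearMap.comp_apply, PiTensorProduct.map_tprod]
  simp only [exteriorPower.toTensorPower_apply_ιMulti]

variable (𝕜 lam mu n) in
/-- The element `d_{lam/mu}(X_T)` of the Schur module. -/
def schurVector (T : Cell lam mu → Fin n) : schurModule 𝕜 (Fin n → 𝕜) lam mu :=
  ⟨schurMap 𝕜 (Fin n → 𝕜) lam mu (rowsX T), LinearMap.mem_range_self _ _⟩

theorem schurVector_span :
    ⊤ ≤ Submodule.span 𝕜 (Set.range (schurVector 𝕜 lam mu n)) := by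
  rintro ⟨_, z, rfl⟩ -
  obtain ⟨y, hy, e⟩ := tensor_mem_of_span (fun i : Fin (lam.colLen 0) =>
      exteriorPower_span_basis (Pi.basisFun 𝕜 (Fin n)) (skewRowLen lam mu i))
    (schurMap 𝕜 (Fin n → 𝕜) lam mu)
    ((Submodule.span 𝕜 (Set.range (schurVector 𝕜 lam mu n))).map
      (schurModule 𝕜 (Fin n → 𝕜) lam mu).subtype)
    (fun p => ⟨schurVector 𝕜 lam mu n fun c => p c.1 c.2, Submodule.subset_span ⟨_, rfl⟩, rfl⟩) z
  have he : y = ⟨schurMap 𝕜 (Fin n → 𝕜) lam mu z, z, rfl⟩ := Subtype.ext e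
  exact he ▸ hy

/-- A row sum is a combination of products of basis vectors with the same content. -/
theorem rowSum_mem_span_content (χ : Perm (Cell lam mu) →* ℤˣ) (T : Cell lam mu → Fin n) :
    rowSum cellRow χ (cellBracket lam mu ι) T ∈
      Submodule.span 𝕜 (cellBracket lam mu ι '' {w | content w = content T}) := by
  refine Submodule.sum_mem _ fun σ _ => ?_
  rw [Units.smul_def, ← Int.cast_smul_eq_zsmul 𝕜]
  exact Submodule.smul_mem _ _ (Submodule.subset_span ⟨_, content_comp T σ, rfl⟩)

variable (𝕜 lam mu n) in
theorem schurVector_standardSystem :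
    StandardSystem (M := schurModule 𝕜 (Fin n → 𝕜) lam mu) (schurRep 𝕜 n lam mu)
      (schurVector 𝕜 lam mu n) (IsStandard cellRow cellCol) := by
  classical
  refine standardSystem_of_rowSum (lam := lam) (mu := mu) (B := SymmetricAlgebra 𝕜 (Fin n → 𝕜))
    (ι := SymmetricAlgebra.ι 𝕜 (Fin n → 𝕜)) (M := schurModule 𝕜 (Fin n → 𝕜) lam mu)
    (j := Submodule.subtype _) (ρ := schurRep 𝕜 n lam mu) (x := schurVector 𝕜 lam mu n)
    (ε := 1) (χ := Perm.sign) (F := fun A => symAlgMap 𝕜 A.toLin')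
    (Ψ := symCoeff (Pi.basisFun 𝕜 (Fin n))) Subtype.val_injective ?_ ?_ ?_ ?_ ?_ ?_ schurVector_span
    ?_ ?_
  · intro u v
    rw [one_smul, mul_comm]
  · intro c d hcd
    rw [Perm.sign_swap hcd]
    simp
  · intro A v
    simp [symAlgMap]
  · intro A y
    rfl
  · intro u _
    rw [symCoeff_prod_map, if_pos (List.Perm.refl u)]
  · intro u L _ h
    rw [symCoeff_prod_map] at h
    by_contra hne
    exact h (if_neg hne)
  · intro T
    change schurMap 𝕜 (Fin n → 𝕜) lam mu (rowsX T) ∈ _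
    rw [schurMap_rowsX]
    exact rowSum_mem_span_content _ T
  · intro T _
    exact schurMap_rowsX T

/-- The element `Y_T`, for a filling `T` given row by row. -/
def rowsY (T : Cell lam mu → Fin n) : DivRows 𝕜 (Fin n → 𝕜) lam mu :=
  PiTensorProduct.tprod 𝕜 fun i => dividedMonomial 𝕜 (Pi.basisFun 𝕜 (Fin n)) (skewRowLen lam mu i)
    (wordContent fun k => T ⟨i, k⟩)

theorem weylMap_rowsY (T : Cell lam mu → Fin n) (hT : Function.Injective T) :
    weylMap 𝕜 (Fin n → 𝕜) lam mu (rowsY T) =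
      rowSum cellRow 1 (cellBracket lam mu (ExteriorAlgebra.ι 𝕜)) T := by
  rw [← placeRows_sum_perm (fun _ => 1) _ (by simp), weylMap, rowsY,
    LinearMap.comp_apply, PiTensorProduct.map_tprod]
  congr 2
  funext i
  have hi : Function.Injective fun k => T ⟨i, k⟩ := fun k k' h => by simpa using hT h
  rw [dividedToTensor_dividedMonomial_of_injective _ hi]
  simp

theorem content_eq_sum_wordContent (T : Cell lam mu → Fin n) (j : Fin n) :
    content T j = ∑ i, wordContent (fun k => T ⟨i, k⟩) j := by
  simp only [wordContent_apply, content, Finset.card_filter]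
  exact Fintype.sum_sigma _

theorem weylMap_rowsY_mem_span (T : Cell lam mu → Fin n) :
    weylMap 𝕜 (Fin n → 𝕜) lam mu (rowsY T) ∈ Submodule.span 𝕜
      (cellBracket lam mu (ExteriorAlgebra.ι 𝕜) '' {w | content w = content T}) := by
  rw [weylMap, rowsY, LinearMap.comp_apply, PiTensorProduct.map_tprod]
  simp only [dividedToTensor_dividedMonomial]
  rw [MultilinearMap.map_sum_finset, map_sum]
  refine Submodule.sum_mem _ fun p hp => Submodule.subset_span ⟨fun c => p c.1 c.2, ?_,
    (placeRows_tprod (ExteriorAlgebra.ι 𝕜) (Pi.basisFun 𝕜 (Fin n)) fun c => p c.1 c.2).symm⟩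
  funext j
  rw [content_eq_sum_wordContent, content_eq_sum_wordContent]
  refine Finset.sum_congr rfl fun i _ => ?_
  have := (Finset.mem_filter.1 (Fintype.mem_piFinset.1 hp i)).2
  rw [← this]

variable (𝕜 lam mu n) in
/-- The element `d'_{lam/mu}(Y_T)` of the Weyl module. -/
def weylVector (T : Cell lam mu → Fin n) : weylModule 𝕜 (Fin n → 𝕜) lam mu :=
  ⟨weylMap 𝕜 (Fin n → 𝕜) lam mu (rowsY T), LinearMap.mem_range_self _ _⟩

theorem weylVector_span :
    ⊤ ≤ Submodule.span 𝕜 (Set.range (weylVector 𝕜 lam mu n)) := by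
  rintro ⟨_, z, rfl⟩ -
  obtain ⟨y, hy, e⟩ := tensor_mem_of_span (fun i : Fin (lam.colLen 0) =>
      dividedMonomial_span (Pi.basisFun 𝕜 (Fin n)) (skewRowLen lam mu i))
    (weylMap 𝕜 (Fin n → 𝕜) lam mu)
    ((Submodule.span 𝕜 (Set.range (weylVector 𝕜 lam mu n))).map
      (weylModule 𝕜 (Fin n → 𝕜) lam mu).subtype)
    (fun p => ⟨weylVector 𝕜 lam mu n fun c => p c.1 c.2, Submodule.subset_span ⟨_, rfl⟩, rfl⟩) z
  have he : y = ⟨weylMap 𝕜 (Fin n → 𝕜) lam mu z, z, rfl⟩ := Subtype.ext e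
  exact he ▸ hy

variable (𝕜 lam mu n) in
theorem weylVector_standardSystem :
    StandardSystem (M := weylModule 𝕜 (Fin n → 𝕜) lam mu) (weylRep 𝕜 n lam mu)
      (weylVector 𝕜 lam mu n) (IsStandard cellRow cellCol) := by
  refine standardSystem_of_rowSum (lam := lam) (mu := mu) (B := ExteriorAlgebra 𝕜 (Fin n → 𝕜))
    (ι := ExteriorAlgebra.ι 𝕜) (M := weylModule 𝕜 (Fin n → 𝕜) lam mu)
    (j := Submodule.subtype _) (ρ := weylRep 𝕜 n lam mu) (x := weylVector 𝕜 lam mu n)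
    (ε := -1) (χ := 1) (F := fun A => ExteriorAlgebra.map A.toLin')
    (Ψ := extCoeff (Pi.basisFun 𝕜 (Fin n))) Subtype.val_injective ?_ ?_ ?_ ?_ ?_ ?_ weylVector_span
    ?_ ?_
  · intro u v
    rw [neg_one_smul, eq_neg_iff_add_eq_zero, ExteriorAlgebra.ι_add_mul_swap]
  · intro c d _
    simp
  · intro A v
    simp
  · intro A y
    rfl
  · intro u hu
    exact extCoeff_prod_map_self _ hu
  · intro u L hu h
    exact perm_of_extCoeff_ne_zero _ hu h
  · intro T
    exact weylMap_rowsY_mem_span T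
  · intro T hT
    exact weylMap_rowsY T hT

end SchurAndWeyl

/-! ### Counting standard fillings -/

section Counting

open Finset

variable {C : Type*} (row col : C → ℕ)

theorem IsStandard.comp_strictMono {row col : C → ℕ} {m n : ℕ} {T : C → Fin m}
    (hT : IsStandard row col T) {f : Fin m → Fin n} (hf : StrictMono f) :
    IsStandard row col (f ∘ T) :=
  ⟨fun c d h1 h2 => hf (hT.1 c d h1 h2), fun c d h1 h2 => hf (hT.2.1 c d h1 h2),
    hf.injective.comp hT.2.2⟩

theorem isStandard_comp_iff {row col : C → ℕ} {m n : ℕ} {T : C → Fin m}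
    {f : Fin m → Fin n} (hf : StrictMono f) :
    IsStandard row col (f ∘ T) ↔ IsStandard row col T :=
  ⟨fun h => ⟨fun c d h1 h2 => hf.lt_iff_lt.1 (h.1 c d h1 h2),
    fun c d h1 h2 => hf.lt_iff_lt.1 (h.2.1 c d h1 h2), h.2.2.of_comp⟩,
    fun h => h.comp_strictMono hf⟩

/-- A standard filling with entries in `[n]` is a standard filling with entries in `[r]`, where `r`
is the number of cells, together with the set of its entries. -/
theorem card_isStandard [Fintype C] {r : ℕ} (hr : Fintype.card C = r) (n : ℕ) :
    Nat.card {T : C → Fin n // IsStandard row col T} =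
      n.choose r * Nat.card {T : C → Fin r // IsStandard row col T} := by
  classical
  have hcard : n.choose r = Nat.card {A : Finset (Fin n) // #A = r} := by
    rw [Nat.card_eq_fintype_card, Fintype.card_finset_len, Fintype.card_fin]
  rw [hcard, ← Nat.card_prod]
  refine (Nat.card_congr (Equiv.ofBijective (fun p : {A : Finset (Fin n) // #A = r} ×
    {T : C → Fin r // IsStandard row col T} => (⟨p.1.1.orderEmbOfFin p.1.2 ∘ p.2.1,
      p.2.2.comp_strictMono (p.1.1.orderEmbOfFin p.1.2).strictMono⟩ :
        {T : C → Fin n // IsStandard row col T})) ?_)).symm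
  have hrange : ∀ (A : Finset (Fin n)) (hA : #A = r) (T : C → Fin r), Function.Injective T →
      univ.image (A.orderEmbOfFin hA ∘ T) = A := by
    intro A hA T hT
    refine Finset.eq_of_subset_of_card_le ?_ ?_
    · intro i hi
      obtain ⟨c, -, rfl⟩ := mem_image.1 hi
      exact A.orderEmbOfFin_mem hA _
    · rw [card_image_of_injective _ ((A.orderEmbOfFin hA).injective.comp hT), card_univ, hr, hA]
  constructor
  · rintro ⟨⟨A, hA⟩, ⟨T, hT⟩⟩ ⟨⟨A', hA'⟩, ⟨T', hT'⟩⟩ h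
    have h' : A.orderEmbOfFin hA ∘ T = A'.orderEmbOfFin hA' ∘ T' := congrArg Subtype.val h
    have hAA : A = A' := by
      rw [← hrange A hA T hT.2.2, h', hrange A' hA' T' hT'.2.2]
    subst hAA
    have : T = T' := (A.orderEmbOfFin hA).injective.comp_left h'
    subst this
    rfl
  · rintro ⟨T, hT⟩
    have hA : #(univ.image T) = r := by rw [card_image_of_injective _ hT.2.2, card_univ, hr]
    have hex : ∀ c, ∃ k, (univ.image T).orderEmbOfFin hA k = T c := by
      intro c
      have : T c ∈ Set.range ((univ.image T).orderEmbOfFin hA) := by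
        rw [Finset.range_orderEmbOfFin]
        exact mem_coe.2 (mem_image_of_mem _ (mem_univ c))
      exact this
    choose S hS using hex
    have hcomp : (univ.image T).orderEmbOfFin hA ∘ S = T := funext hS
    exact ⟨⟨⟨_, hA⟩, ⟨S, (isStandard_comp_iff ((univ.image T).orderEmbOfFin hA).strictMono).1
      (hcomp.symm ▸ hT)⟩⟩, Subtype.ext hcomp⟩

theorem card_isStandard_lt {r N : ℕ} (hN : r ≤ N) :
    Nat.card {T : {T : C → Fin N // IsStandard row col T} // ∀ c, (T.1 c : ℕ) < r} =
      Nat.card {T : C → Fin r // IsStandard row col T} := by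
  refine Nat.card_congr
    { toFun := fun T => ⟨fun c => ⟨T.1.1 c, T.2 c⟩, ?_⟩
      invFun := fun T => ⟨⟨Fin.castLE hN ∘ T.1,
        T.2.comp_strictMono (Fin.strictMono_castLE hN)⟩, fun c => (T.1 c).2⟩
      left_inv := fun T => rfl
      right_inv := fun T => rfl }
  exact (isStandard_comp_iff (Fin.strictMono_castLE hN)).1 T.1.2

end Counting

namespace StandardSystem

variable {𝕜 : Type*} [Field 𝕜] [Infinite 𝕜] {lam mu : YoungDiagram} {n r N : ℕ}
  {M : Type*} [AddCommGroup M] [Module 𝕜 M] {ρ : Representation 𝕜 (Matrix (Fin n) (Fin n) 𝕜) M}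
  {x : (Cell lam mu → Fin n) → M}
  {M' : Type*} [AddCommGroup M'] [Module 𝕜 M']
  {ρ' : Representation 𝕜 (Matrix (Fin N) (Fin N) 𝕜) M'} {x' : (Cell lam mu → Fin N) → M'}

theorem exists_basis (h : StandardSystem ρ x (IsStandard cellRow cellCol))
    (hr : Fintype.card (Cell lam mu) = r) :
    ∃ b : Basis (DistinctTableau lam mu n) 𝕜 (SymmetrizedSchur ρ r),
      ∀ T, b T = (nonSquareFree ρ r).mkQ (x (T.entry ∘ cellEquiv lam mu)) :=
  ⟨(h.basis hr).reindex (tableauEquiv lam mu n).symm, fun T => by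
    rw [Basis.reindex_apply, Equiv.symm_symm, h.basis_apply]
    rfl⟩

theorem finrank_symmetrizedSchur (h : StandardSystem ρ x (IsStandard cellRow cellCol))
    (h' : StandardSystem ρ' x' (IsStandard cellRow cellCol))
    (hr : Fintype.card (Cell lam mu) = r) (hN : r ≤ N) :
    finrank 𝕜 (SymmetrizedSchur ρ r) = n.choose r * finrank 𝕜 (schurFunctor ρ' r) := by
  rw [finrank_eq_nat_card_basis (h.basis hr), h'.finrank_schurFunctor hr,
    card_isStandard_lt _ _ hN, card_isStandard _ _ hr]

end StandardSystem

end SchurWeyl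

end

theorem mainTheorem9 (𝕜 : Type*) [Field 𝕜] [Infinite 𝕜] (n r : ℕ) (lam mu : YoungDiagram)
    (hle : mu ≤ lam) (hr : lam.card = mu.card + r) :
    (∃ b : Module.Basis (SchurWeyl.DistinctTableau lam.transpose mu.transpose n) 𝕜
        (SchurWeyl.UpperR 𝕜 n lam mu r),
      ∀ T, b T = SchurWeyl.upperClass 𝕜 n lam mu r T.entry) ∧
    (∃ b : Module.Basis (SchurWeyl.DistinctTableau lam mu n) 𝕜 (SchurWeyl.LowerR 𝕜 n lam mu r),
      ∀ T, b T = SchurWeyl.lowerClass 𝕜 n lam mu r T.entry) ∧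
    (∀ N : ℕ, r ≤ N →
      Module.finrank 𝕜 (SchurWeyl.UpperR 𝕜 n lam mu r) =
        n.choose r * Module.finrank 𝕜 (SchurWeyl.skewSpecht 𝕜 N lam mu r)) ∧
    (∀ N : ℕ, r ≤ N →
      Module.finrank 𝕜 (SchurWeyl.LowerR 𝕜 n lam mu r) =
        n.choose r * Module.finrank 𝕜 (SchurWeyl.dualSkewSpecht 𝕜 N lam mu r)) := by
  have hcard := SchurWeyl.card_cell hle hr
  have hcard' : Fintype.card (SchurWeyl.Cell lam.transpose mu.transpose) = r := by
    refine SchurWeyl.card_cell (YoungDiagram.transpose_mono hle) ?_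
    simpa [YoungDiagram.card, YoungDiagram.transpose] using hr
  refine ⟨?_, ?_, fun N hN => ?_, fun N hN => ?_⟩
  · exact (SchurWeyl.schurVector_standardSystem 𝕜 lam.transpose mu.transpose n).exists_basis hcard'
  · exact (SchurWeyl.weylVector_standardSystem 𝕜 lam mu n).exists_basis hcard
  · exact (SchurWeyl.schurVector_standardSystem 𝕜 lam.transpose mu.transpose
      n).finrank_symmetrizedSchur
      (SchurWeyl.schurVector_standardSystem 𝕜 lam.transpose mu.transpose N) hcard' hN
  · exact (SchurWeyl.weylVector_standardSystem 𝕜 lam mu n).finrank_symmetrizedSchur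
      (SchurWeyl.weylVector_standardSystem 𝕜 lam mu N) hcard hN
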